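/- A convex $3$-polytope is a bounded set $P=\{x\in\mathbb R^3: \langle a_i,x\rangle+b_i\ge 0,\ i=1,\dots,m\}$ with nonempty interior, where no inequality can be deleted without changing the set. Its facets are $F_i=P\cap\{x:\langle a_i,x\rangle+b_i=0\}$, its faces are the intersections of facets, its vertices and edges are its faces of dimension $0$ and $1$, and a facet is a $k$-gon if it contains exactly $k$ edges. $P$ is simple if every vertex lies in exactly three facets. A $k$-belt of a simple $3$-polytope is a cyclic sequence of facets $(F_{i_1},\dots,F_{i_k})$ (considered up to the choice of the starting point and of the direction) such that $F_{i_1}\cap F_{i_2},\dots,F_{i_{k-1}}\cap F_{i_k},F_{i_k}\cap F_{i_1}$ are edges, $F_{i_1}\cap\dots\cap F_{i_k}=\varnothing$, and, for $p\ne q$, $F_{i_p}\cap F_{i_q}\neq\varnothing$ if and only if $\{p,q\}\in\{\{1,2\},\dots,\{k-1,k\},\{k,1\}\}$. It surrounds a facet $F$ if $F\cap F_{i_1},\dots,F\cap F_{i_k}$ are the edges of $F$, each listed once, in the cyclic order in which they occur along the boundary of $F$. **Theorem.** Let $P$ be a simple convex $3$-polytope all of whose facets are pentagons and hexagons, with at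 most one exceptional facet, which is a quadrangle or a heptagon. 1. If $P$ has no quadrangle, then $P$ has no $4$-belts. 2. If $P$ has a quadrangle $F$, then $P$ has exactly one $4$-belt, and this belt surrounds $F$. In particular, fullerenes (simple convex $3$-polytopes all of whose facets are pentagons and hexagons) have no $4$-belts. -/

import Mathlib

/-- An `n`-dimensional convex polytope in `ℝⁿ`: a bounded set with nonempty interior, given by an
irredundant system of `m` inequalities `⟨aᵢ, x⟩ + bᵢ ≥ 0` (deleting any of them changes the set). -/
structure ConvexPolytope (n : ℕ) where
  m : ℕ
  a : Fin m → EuclideanSpace ℝ (Fin n)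
  b : Fin m → ℝ
  bounded : Bornology.IsBounded {x : EuclideanSpace ℝ (Fin n) | ∀ i, 0 ≤ inner ℝ (a i) x + b i}
  irredundant : ∀ i, {x : EuclideanSpace ℝ (Fin n) | ∀ j, j ≠ i → 0 ≤ inner ℝ (a j) x + b j} ≠
    {x : EuclideanSpace ℝ (Fin n) | ∀ j, 0 ≤ inner ℝ (a j) x + b j}
  fullDim : (interior
    {x : EuclideanSpace ℝ (Fin n) | ∀ i, 0 ≤ inner ℝ (a i) x + b i}).Nonempty

namespace ConvexPolytope

/-- The underlying point set of the polytope. -/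
def carrier {n : ℕ} (P : ConvexPolytope n) : Set (EuclideanSpace ℝ (Fin n)) :=
  {x | ∀ i, 0 ≤ inner ℝ (P.a i) x + P.b i}

/-- The `i`-th facet: the part of the polytope in the `i`-th hyperplane. Irredundancy makes
different indices give different facets, so facets are referred to by their indices. -/
def facet {n : ℕ} (P : ConvexPolytope n) (i : Fin P.m) : Set (EuclideanSpace ℝ (Fin n)) :=
  {x | x ∈ P.carrier ∧ inner ℝ (P.a i) x + P.b i = 0}

/-- A face is an intersection of facets (the empty intersection being the polytope itself). -/
def IsFace {n : ℕ} (P : ConvexPolytope n) (G : Set (EuclideanSpace ℝ (Fin n))) : Prop :=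
  ∃ S : Finset (Fin P.m), G = P.carrier ∩ ⋂ i ∈ S, P.facet i

/-- A vertex is a point that is a face. -/
def IsVertex {n : ℕ} (P : ConvexPolytope n) (v : EuclideanSpace ℝ (Fin n)) : Prop :=
  P.IsFace {v}

/-- An edge is a face of dimension one. -/
def IsEdge {n : ℕ} (P : ConvexPolytope n) (G : Set (EuclideanSpace ℝ (Fin n))) : Prop :=
  P.IsFace G ∧ Module.finrank ℝ (vectorSpan ℝ G) = 1

/-- An `n`-polytope is simple if each of its vertices lies in exactly `n` facets. -/
def IsSimple {n : ℕ} (P : ConvexPolytope n) : Prop :=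
  ∀ v, P.IsVertex v → {i | v ∈ P.facet i}.ncard = n

/-- The edges of a facet of a `3`-polytope: the edges of the polytope contained in it. -/
def edgesOf (P : ConvexPolytope 3) (i : Fin P.m) : Set (Set (EuclideanSpace ℝ (Fin 3))) :=
  {G | P.IsEdge G ∧ G ⊆ P.facet i}

/-- The `i`-th facet is a `k`-gon. -/
def IsGon (P : ConvexPolytope 3) (k : ℕ) (i : Fin P.m) : Prop :=
  (P.edgesOf i).ncard = k

/-- A `k`-loop: a cyclic sequence of `k` facets such that successive ones meet in an edge. -/
def IsLoop (P : ConvexPolytope 3) {k : ℕ} (B : ZMod k → Fin P.m) : Prop :=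
  ∀ j, P.IsEdge (P.facet (B j) ∩ P.facet (B (j + 1)))

/-- A `k`-belt: a `k`-loop whose facets have no point common to all of them, and in which two
facets at different positions intersect if and only if the positions are successive. -/
def IsBelt (P : ConvexPolytope 3) {k : ℕ} (B : ZMod k → Fin P.m) : Prop :=
  P.IsLoop B ∧ (⋂ j, P.facet (B j)) = ∅ ∧
    ∀ p q, p ≠ q → ((P.facet (B p) ∩ P.facet (B q)).Nonempty ↔ q = p + 1 ∨ p = q + 1)

/-- The cyclic sequence `B` of `k` facets surrounds the facet `i`: it lists the facets met when
walking once along the boundary of the facet `i`, on the other side. That is, the sets `Fᵢ ∩ B j`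
are all the edges of `Fᵢ`, each listed once, and successive edges share a vertex. -/
def Surrounds (P : ConvexPolytope 3) {k : ℕ} (B : ZMod k → Fin P.m) (i : Fin P.m) : Prop :=
  Function.Injective (fun j => P.facet i ∩ P.facet (B j)) ∧
    Set.range (fun j => P.facet i ∩ P.facet (B j)) = P.edgesOf i ∧
    ∀ j, (P.facet i ∩ P.facet (B j) ∩ P.facet (B (j + 1))).Nonempty

/-- All facets are pentagons and hexagons, except at most one, a quadrangle or a heptagon. -/
def PentHexWithException (P : ConvexPolytope 3) : Prop :=
  (∀ i, P.IsGon 4 i ∨ P.IsGon 5 i ∨ P.IsGon 6 i ∨ P.IsGon 7 i) ∧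
    ∀ i j, (P.IsGon 4 i ∨ P.IsGon 7 i) → (P.IsGon 4 j ∨ P.IsGon 7 j) → i = j

/-- A (combinatorial) fullerene: a simple `3`-polytope with all facets pentagons and hexagons. -/
def IsFullerene (P : ConvexPolytope 3) : Prop :=
  P.IsSimple ∧ ∀ i, P.IsGon 5 i ∨ P.IsGon 6 i

end ConvexPolytope

/-- Two indexed sequences are the same cyclic sequence: they agree up to the choice of the
starting point and of the direction of traversal. -/
def SameCyclic {k : ℕ} {α : Type*} (B C : ZMod k → α) : Prop :=
  (∃ s, ∀ j, C j = B (s + j)) ∨ ∃ s, ∀ j, C j = B (s - j)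

/-! Each vertex of a simple polytope is recorded as the triple of facets through it, giving a family
`K`. A generic linear functional yields the connectedness of the faces and of the graph, and Euler's
inequality `#K + 4 ≤ 2 * Fintype.card ι`. Linear algebra mod 2 turns these into a Jordan curve
theorem (`exists_cut_eq`): an edge set meeting every facet evenly is the cut of some vertex set `A`.
So the edges between successive facets of a k-belt split the vertices into two sides.

Let `A` be one side, k = 3 or 4, and let D be the set of facets with all vertices in `A`. Euler's
formula for the side is 2 #D + k = #A + 2. The weight of `A` is the number of incidences between `A`
and the belt facets. Each vertex has three facets, so weight = 3k - 6 + ∑ (6 - degree) over D. The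
weights of the two sides add up to the sum of the degrees of the belt facets, at most 6k + 1, and at
most 6k if the belt contains no heptagon.

It remains to show that weights are large. Peeling off the vertices on the belt leaves a core, whose
cut has at most weight - 2k edges. If the weight is at most 3k, counting with degrees at least 5
(one exception of degree 4) makes the core the side of another k-belt, unless k = 4 and the side
consists of the vertices of one quadrangle. Without a heptagon inside, the core weighs no more than
the side, so descent gives weight at least 3k + 1 for sides with no exceptional facet inside.

Two such sides exceed 6k + 1. For k = 3, an exceptional quadrangle inside does not harm the bound,
and with a heptagon inside the bound 9 survives, which suffices against 18; so there are no 3-belts.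
For k = 4, an exceptional facet inside one side leaves it weight at most 24 - 13 = 11, so the side
is a quadrangle. Conversely, the neighbours of a quadrangle form a chordless 4-cycle because there
are no 3-belts, and four facets carry only one such cycle. -/

open Finset

/-- Combinatorial data of a simple `3`-polytope with facets indexed by `ι`: the set `K` of vertices,
each given by the set of the three facets through it. `exists_height` records a generic linear
functional: a vertex of `t` that is not optimal on a face has a better neighbour in this face. -/
structure IsSimpleSphere {ι : Type*} [DecidableEq ι] (K : Finset (Finset ι)) : Prop where
  card_eq : ∀ t ∈ K, #t = 3
  cover : ∀ i, ∃ t ∈ K, i ∈ t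
  card_star : ∀ t ∈ K, ∀ i ∈ t, #{s ∈ K | t.erase i ⊆ s} = 2
  exists_height : ∃ h : Finset ι → ℝ, Set.InjOn h K ∧
    (∀ t ∈ K, ∀ u ∈ K, h t < h u → ∃ s ∈ K, ∃ i ∈ t, i ∉ u ∧ t.erase i ⊆ s ∧ h t < h s) ∧
    (∀ t ∈ K, ∀ u ∈ K, h u < h t → ∃ s ∈ K, ∃ i ∈ t, i ∉ u ∧ t.erase i ⊆ s ∧ h s < h t)

/-! ### Connectedness of faces and Euler's inequality -/

namespace IsSimpleSphere

variable {ι : Type*} [DecidableEq ι] {K : Finset (Finset ι)}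

/-- A function on the vertices of a face that is constant along the edges of the face is constant. -/
theorem eq_of_adj (hK : IsSimpleSphere K) {α : Type*} (X : Finset ι) (f : Finset ι → α)
    (hf : ∀ t ∈ K, ∀ u ∈ K, ∀ j ∈ t, t.erase j ⊆ u → X ⊆ t.erase j → f t = f u)
    {t u : Finset ι} (ht : t ∈ K) (hu : u ∈ K) (hXt : X ⊆ t) (hXu : X ⊆ u) : f t = f u := by
  obtain ⟨h, hinj, hasc, -⟩ := hK.exists_height
  obtain ⟨M, hM, hmax⟩ := exists_max_image {s ∈ K | X ⊆ s} h ⟨t, by simp [ht, hXt]⟩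
  simp only [mem_filter, and_imp] at hM hmax
  -- Climb to the highest vertex `M` of the face `X`, by induction on the number of vertices above
  -- `s`. The improving edge given by `hasc` drops a facet not through `M`, hence not in `X`, so the
  -- climb stays in the face.
  have key : ∀ n, ∀ s ∈ K, X ⊆ s → #{r ∈ K | h s < h r} = n → f s = f M := by
    intro n
    induction n using Nat.strong_induction_on with
    | _ n ih =>
      intro s hs hXs hn
      rcases (hmax s hs hXs).lt_or_eq with hlt | heq
      · obtain ⟨r, hr, i, hi, hiM, hsub, hsr⟩ := hasc s hs M hM.1 hlt
        have hX : X ⊆ s.erase i := fun x hx =>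
          mem_erase.2 ⟨fun e => hiM (e ▸ hM.2 hx), hXs hx⟩
        rw [hf s hs r hr i hi hsub hX]
        refine ih _ ?_ r hr (hX.trans hsub) rfl
        rw [← hn]
        refine card_lt_card ⟨fun x hx => ?_, fun hcon => ?_⟩
        · simp only [mem_filter] at hx ⊢
          exact ⟨hx.1, hsr.trans hx.2⟩
        · have := hcon (mem_filter.2 ⟨hr, hsr⟩)
          simp at this
      · rw [hinj hs hM.1 heq]
  rw [key _ t ht hXt rfl, key _ u hu hXu rfl]

theorem exists_neighbor (hK : IsSimpleSphere K) {t : Finset ι} (ht : t ∈ K) {i : ι} (hi : i ∈ t) :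
    ∃ s ∈ K, s ≠ t ∧ t.erase i ⊆ s ∧ ∀ r ∈ K, t.erase i ⊆ r → r = t ∨ r = s := by
  obtain ⟨x, y, hxy, he⟩ := card_eq_two.1 (hK.card_star t ht i hi)
  have hm : ∀ r, (r ∈ K ∧ t.erase i ⊆ r) ↔ r = x ∨ r = y := fun r => by
    simpa using Finset.ext_iff.1 he r
  rcases (hm t).1 ⟨ht, erase_subset _ _⟩ with rfl | rfl
  · exact ⟨y, ((hm y).2 (Or.inr rfl)).1, hxy.symm, ((hm y).2 (Or.inr rfl)).2,
      fun r hr h => (hm r).1 ⟨hr, h⟩⟩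
  · exact ⟨x, ((hm x).2 (Or.inl rfl)).1, hxy, ((hm x).2 (Or.inl rfl)).2,
      fun r hr h => ((hm r).1 ⟨hr, h⟩).symm⟩

/-- Double count: `h` is injective on vertices, so every facet has exactly one highest vertex. -/
theorem sum_card_facetMax [Fintype ι] (hK : IsSimpleSphere K) {h : Finset ι → ℝ}
    (hinj : Set.InjOn h K) :
    ∑ t ∈ K, #{i ∈ t | ∀ u ∈ K, i ∈ u → h u ≤ h t} = Fintype.card ι := by
  classical
  have h1 : ∀ t ∈ K, #{i ∈ t | ∀ u ∈ K, i ∈ u → h u ≤ h t} =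
      #(bipartiteAbove (fun t i => i ∈ t ∧ ∀ u ∈ K, i ∈ u → h u ≤ h t) univ t) := by
    intro t _
    congr 1
    ext i
    simp [bipartiteAbove]
  rw [sum_congr rfl h1, sum_card_bipartiteAbove_eq_sum_card_bipartiteBelow]
  rw [sum_congr rfl (g := fun _ => 1), sum_const, smul_eq_mul, mul_one, card_univ]
  intro i _
  obtain ⟨t, ht, hit⟩ := hK.cover i
  obtain ⟨M, hM, hmax⟩ := exists_max_image {s ∈ K | i ∈ s} h ⟨t, by simp [ht, hit]⟩
  simp only [mem_filter, and_imp] at hM hmax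
  rw [card_eq_one]
  refine ⟨M, ?_⟩
  ext s
  simp only [bipartiteBelow, mem_filter, mem_singleton]
  constructor
  · rintro ⟨hs, his, hm⟩
    exact hinj hs hM.1 (le_antisymm (hmax s hs his) (hm M hM.1 hM.2))
  · rintro rfl
    exact ⟨hM.1, hM.2, fun u hu hiu => hmax u hu hiu⟩

/-- Half of Euler's formula. -/
theorem card_add_four_le [Fintype ι] [Nonempty ι] (hK : IsSimpleSphere K) :
    #K + 4 ≤ 2 * Fintype.card ι := by
  classical
  obtain ⟨h, hinj, hasc, hdesc⟩ := hK.exists_height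
  have hinj' : Set.InjOn (fun t => - h t) K := fun x hx y hy e => hinj hx hy (neg_injective e)
  have s1 := hK.sum_card_facetMax hinj
  have s2 := hK.sum_card_facetMax hinj'
  simp only [neg_le_neg_iff] at s2
  obtain ⟨i0⟩ := ‹Nonempty ι›
  obtain ⟨t0, ht0, hi0⟩ := hK.cover i0
  obtain ⟨t1, ht1, hne, -⟩ := hK.exists_neighbor ht0 hi0
  obtain ⟨M, hM, hmax⟩ := exists_max_image K h ⟨t0, ht0⟩
  obtain ⟨m, hm, hmin⟩ := exists_min_image K h ⟨t0, ht0⟩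
  have hMm : M ≠ m := by
    rintro rfl
    have e0 := hinj ht0 hM (le_antisymm (hmax _ ht0) (hmin _ ht0))
    have e1 := hinj ht1 hM (le_antisymm (hmax _ ht1) (hmin _ ht1))
    exact hne (e1.trans e0.symm)
  -- Two of the three edges at `t` go the same way in height, and the facet containing both has its
  -- maximum or minimum at `t`. At the top and at the bottom vertex all three facets count, whence
  -- the surplus of 2 + 2.
  have key : ∀ t ∈ K, 1 + ((if t = M then 2 else 0) + (if t = m then 2 else 0)) ≤
      #{i ∈ t | ∀ u ∈ K, i ∈ u → h u ≤ h t} + #{i ∈ t | ∀ u ∈ K, i ∈ u → h t ≤ h u} := by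
    intro t ht
    by_cases hM' : t = M
    · subst hM'
      rw [if_pos rfl, if_neg hMm]
      have : {i ∈ t | ∀ u ∈ K, i ∈ u → h u ≤ h t} = t :=
        filter_true_of_mem fun i _ u hu _ => hmax u hu
      rw [this, hK.card_eq t ht]
      omega
    by_cases hm' : t = m
    · subst hm'
      rw [if_neg hM', if_pos rfl]
      have : {i ∈ t | ∀ u ∈ K, i ∈ u → h t ≤ h u} = t :=
        filter_true_of_mem fun i _ u hu _ => hmin u hu
      rw [this, hK.card_eq t ht]
      omega
    rw [if_neg hM', if_neg hm']
    have hLU : ∀ j ∈ t, (∀ s ∈ K, t.erase j ⊆ s → h s ≤ h t) ∨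
        (∀ s ∈ K, t.erase j ⊆ s → h t ≤ h s) := by
      intro j hj
      obtain ⟨s, hs, -, -, hr⟩ := hK.exists_neighbor ht hj
      rcases le_total (h s) (h t) with hle | hle
      · left
        intro r hrK hsub
        rcases hr r hrK hsub with rfl | rfl
        exacts [le_rfl, hle]
      · right
        intro r hrK hsub
        rcases hr r hrK hsub with rfl | rfl
        exacts [le_rfl, hle]
    have hL : ∀ i ∈ t, (∀ j ∈ t, j ≠ i → ∀ s ∈ K, t.erase j ⊆ s → h s ≤ h t) →
        1 ≤ #{i ∈ t | ∀ u ∈ K, i ∈ u → h u ≤ h t} := by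
      intro i hi hj
      refine card_pos.2 ⟨i, mem_filter.2 ⟨hi, fun u hu hiu => ?_⟩⟩
      by_contra! hlt
      obtain ⟨s, hs, j, hjt, hju, hsub, hts⟩ := hasc t ht u hu hlt
      exact absurd (hj j hjt (fun e => hju (e ▸ hiu)) s hs hsub) (not_le.2 hts)
    have hU : ∀ i ∈ t, (∀ j ∈ t, j ≠ i → ∀ s ∈ K, t.erase j ⊆ s → h t ≤ h s) →
        1 ≤ #{i ∈ t | ∀ u ∈ K, i ∈ u → h t ≤ h u} := by
      intro i hi hj
      refine card_pos.2 ⟨i, mem_filter.2 ⟨hi, fun u hu hiu => ?_⟩⟩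
      by_contra! hlt
      obtain ⟨s, hs, j, hjt, hju, hsub, hts⟩ := hdesc t ht u hu hlt
      exact absurd (hj j hjt (fun e => hju (e ▸ hiu)) s hs hsub) (not_le.2 hts)
    obtain ⟨a, b, c, hab, hac, hbc, rfl⟩ := card_eq_three.1 (hK.card_eq t ht)
    have ha := hLU a (by simp)
    have hb := hLU b (by simp)
    have hc := hLU c (by simp)
    have La := hL a (by simp)
    have Lb := hL b (by simp)
    have Lc := hL c (by simp)
    have Ua := hU a (by simp)
    have Ub := hU b (by simp)
    have Uc := hU c (by simp)
    simp only [mem_insert, mem_singleton, forall_eq_or_imp, forall_eq] at La Lb Lc Ua Ub Uc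
    rcases ha with ha | ha <;> rcases hb with hb | hb <;> rcases hc with hc | hc
    all_goals
      first
      | have := La ⟨by simp, fun _ => hb, fun _ => hc⟩; omega
      | have := Lb ⟨fun _ => ha, by simp, fun _ => hc⟩; omega
      | have := Lc ⟨fun _ => ha, fun _ => hb, by simp⟩; omega
      | have := Ua ⟨by simp, fun _ => hb, fun _ => hc⟩; omega
      | have := Ub ⟨fun _ => ha, by simp, fun _ => hc⟩; omega
      | have := Uc ⟨fun _ => ha, fun _ => hb, by simp⟩; omega
  have := sum_le_sum key
  simp only [sum_add_distrib, sum_ite_eq', hM, hm, if_true, sum_const, smul_eq_mul, mul_one] at this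
  omega

end IsSimpleSphere

/-! ### Edges, cuts and parity -/

namespace FacetTriples

variable {ι : Type*} [DecidableEq ι]

/-- The edges: pairs of facets with a common vertex. -/
def edges (K : Finset (Finset ι)) : Finset (Finset ι) := K.biUnion (powersetCard 2)

/-- The edges with exactly one end in the set `A` of vertices. -/
def cut (K A : Finset (Finset ι)) : Finset (Finset ι) := {e ∈ edges K | #{t ∈ A | e ⊆ t} = 1}

/-- The edges with both ends in the set `A` of vertices. -/
def innerEdges (K A : Finset (Finset ι)) : Finset (Finset ι) :=
  {e ∈ edges K | #{t ∈ A | e ⊆ t} = 2}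

/-- The facets incident to an edge of the cut. -/
def rim (K A : Finset (Finset ι)) : Finset ι := (cut K A).biUnion id

/-- The facets with all vertices in `A`. -/
def innerFacets [Fintype ι] (K A : Finset (Finset ι)) : Finset ι := {i | ∀ t ∈ K, i ∈ t → t ∈ A}

/-- The number of edges, equivalently of vertices, of a facet. -/
def degree (K : Finset (Finset ι)) (i : ι) : ℕ := #{t ∈ K | i ∈ t}

/-- The number of incidences between the rim of `A` and the vertices in `A`. -/
def weight (K A : Finset (Finset ι)) : ℕ := ∑ i ∈ rim K A, #{t ∈ A | i ∈ t}

theorem mem_edges {K : Finset (Finset ι)} {e : Finset ι} :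
    e ∈ edges K ↔ ∃ t ∈ K, e ⊆ t ∧ #e = 2 := by
  simp [edges, mem_powersetCard]

theorem card_of_mem_edges {K : Finset (Finset ι)} {e : Finset ι} (he : e ∈ edges K) : #e = 2 := by
  obtain ⟨t, -, -, h⟩ := mem_edges.1 he
  exact h

theorem mem_edges_of_subset {K : Finset (Finset ι)} {e t : Finset ι} (ht : t ∈ K) (h : e ⊆ t)
    (he : #e = 2) : e ∈ edges K := mem_edges.2 ⟨t, ht, h, he⟩

theorem cut_subset (K A : Finset (Finset ι)) : cut K A ⊆ edges K := filter_subset _ _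

theorem mem_rim {K A : Finset (Finset ι)} {i : ι} :
    i ∈ rim K A ↔ ∃ e ∈ cut K A, i ∈ e := by simp [rim]

theorem subset_rim {K A : Finset (Finset ι)} {e : Finset ι} (he : e ∈ cut K A) :
    e ⊆ rim K A := fun _ hi => mem_rim.2 ⟨e, he, hi⟩

end FacetTriples

open FacetTriples

namespace IsSimpleSphere

variable {ι : Type*} [DecidableEq ι] {K A : Finset (Finset ι)}

theorem erase_mem_edges (hK : IsSimpleSphere K) {t : Finset ι} (ht : t ∈ K) {i : ι} (hi : i ∈ t) :
    t.erase i ∈ edges K :=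
  mem_edges_of_subset ht (erase_subset _ _) (by rw [card_erase_of_mem hi, hK.card_eq t ht])

theorem exists_eq_erase (hK : IsSimpleSphere K) {t e : Finset ι} (ht : t ∈ K) (he : e ⊆ t)
    (h2 : #e = 2) : ∃ i ∈ t, e = t.erase i := by
  have : #(t \ e) = 1 := by rw [card_sdiff_of_subset he, hK.card_eq t ht, h2]
  obtain ⟨i, hi⟩ := card_eq_one.1 this
  have hi' : i ∈ t \ e := by simp [hi]
  rw [mem_sdiff] at hi'
  refine ⟨i, hi'.1, eq_of_subset_of_card_le (fun x hx => mem_erase.2 ⟨?_, he hx⟩) ?_⟩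
  · rintro rfl
    exact hi'.2 hx
  · rw [card_erase_of_mem hi'.1, hK.card_eq t ht, h2]

theorem card_filter_subset (hK : IsSimpleSphere K) {e : Finset ι} (he : e ∈ edges K) :
    #{t ∈ K | e ⊆ t} = 2 := by
  obtain ⟨t, ht, hsub, h2⟩ := mem_edges.1 he
  obtain ⟨i, hi, rfl⟩ := hK.exists_eq_erase ht hsub h2
  exact hK.card_star t ht i hi

theorem eq_or_eq (hK : IsSimpleSphere K) {e t u r : Finset ι} (h2 : #e = 2) (ht : t ∈ K)
    (hu : u ∈ K) (hr : r ∈ K) (het : e ⊆ t) (heu : e ⊆ u) (her : e ⊆ r) (hne : t ≠ u) :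
    r = t ∨ r = u := by
  by_contra! hcon
  have h3 : #({t, u, r} : Finset (Finset ι)) = 3 :=
    card_eq_three.2 ⟨t, u, r, hne, hcon.1.symm, hcon.2.symm, rfl⟩
  have : ({t, u, r} : Finset (Finset ι)) ⊆ {t ∈ K | e ⊆ t} := by
    intro x hx
    simp only [mem_insert, mem_singleton] at hx
    rcases hx with rfl | rfl | rfl <;> simp [*]
  have := card_le_card this
  rw [hK.card_filter_subset (mem_edges_of_subset ht het h2)] at this
  omega

theorem card_filter_subset_add (hK : IsSimpleSphere K) (hA : A ⊆ K) {e : Finset ι}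
    (he : e ∈ edges K) : #{t ∈ A | e ⊆ t} + #{t ∈ K \ A | e ⊆ t} = 2 := by
  rw [← hK.card_filter_subset he, ← card_union_of_disjoint, ← filter_union,
    union_sdiff_of_subset hA]
  exact disjoint_filter_filter disjoint_sdiff

theorem mem_cut_iff (hK : IsSimpleSphere K) (hA : A ⊆ K) {e : Finset ι} :
    e ∈ cut K A ↔ #e = 2 ∧ ∃ t ∈ A, ∃ u ∈ K, u ∉ A ∧ e ⊆ t ∧ e ⊆ u := by
  constructor
  · intro h
    obtain ⟨he, h1⟩ := mem_filter.1 h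
    have h2 := hK.card_filter_subset_add hA he
    obtain ⟨t, ht⟩ := card_pos.1 (by omega : 0 < #{t ∈ A | e ⊆ t})
    obtain ⟨u, hu⟩ := card_pos.1 (by omega : 0 < #{t ∈ K \ A | e ⊆ t})
    simp only [mem_filter, mem_sdiff] at ht hu
    exact ⟨card_of_mem_edges he, t, ht.1, u, hu.1.1, hu.1.2, ht.2, hu.2⟩
  · rintro ⟨h2, t, ht, u, hu, huA, het, heu⟩
    have he := mem_edges_of_subset hu heu h2
    refine mem_filter.2 ⟨he, ?_⟩
    have h3 := hK.card_filter_subset_add hA he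
    have h4 : 0 < #{t ∈ A | e ⊆ t} := card_pos.2 ⟨t, by simp [*]⟩
    have h5 : 0 < #{t ∈ K \ A | e ⊆ t} := card_pos.2 ⟨u, by simp [*]⟩
    omega

theorem cut_sdiff (hK : IsSimpleSphere K) (hA : A ⊆ K) : cut K (K \ A) = cut K A := by
  ext e
  rw [hK.mem_cut_iff hA, hK.mem_cut_iff sdiff_subset]
  refine and_congr_right fun _ => ⟨?_, ?_⟩
  · rintro ⟨t, ht, u, hu, huA, h1, h2⟩
    rw [mem_sdiff] at ht huA
    exact ⟨u, by tauto, t, ht.1, ht.2, h2, h1⟩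
  · rintro ⟨t, ht, u, hu, huA, h1, h2⟩
    exact ⟨u, by simp [*], t, hA ht, by simp [*], h2, h1⟩

theorem rim_sdiff (hK : IsSimpleSphere K) (hA : A ⊆ K) :
    rim K (K \ A) = rim K A := by rw [rim, rim, hK.cut_sdiff hA]

/-- A walk along the boundary of a facet off the rim crosses no cut edge, so it never changes sides.
-/
theorem mem_iff_of_notMem_rim (hK : IsSimpleSphere K) (hA : A ⊆ K) {i : ι}
    (hi : i ∉ rim K A) {t u : Finset ι} (ht : t ∈ K) (hu : u ∈ K) (hit : i ∈ t)
    (hiu : i ∈ u) : t ∈ A ↔ u ∈ A := by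
  have := hK.eq_of_adj {i} (fun t => t ∈ A) ?_ ht hu (by simpa) (by simpa)
  · simpa using this
  intro t ht u hu j hj hsub hX
  have h2 : #(t.erase j) = 2 := by rw [card_erase_of_mem hj, hK.card_eq t ht]
  have hX' : i ∈ t.erase j := by simpa using hX
  have hn : t.erase j ∉ cut K A := fun h => hi (mem_rim.2 ⟨_, h, hX'⟩)
  rw [hK.mem_cut_iff hA] at hn
  refine propext ⟨fun h => ?_, fun h => ?_⟩
  · by_contra hcon
    exact hn ⟨h2, t, h, u, hu, hcon, erase_subset _ _, hsub⟩
  · by_contra hcon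
    exact hn ⟨h2, u, h, t, ht, hcon, hsub, erase_subset _ _⟩

theorem cut_nonempty (hK : IsSimpleSphere K) (hA : A ⊆ K) (h0 : A.Nonempty) (h1 : A ≠ K) :
    (cut K A).Nonempty := by
  by_contra hcon
  rw [not_nonempty_iff_eq_empty] at hcon
  obtain ⟨u, hu, huA⟩ : ∃ u ∈ K, u ∉ A := by
    by_contra! h
    exact h1 (Subset.antisymm hA h)
  obtain ⟨t, ht⟩ := h0
  have := hK.eq_of_adj ∅ (fun t => t ∈ A) ?_ (hA ht) hu (by simp) (by simp)
  · simp only [ht, huA, eq_iff_iff, true_iff] at this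
  intro t ht u hu j hj hsub _
  have h2 : #(t.erase j) = 2 := by rw [card_erase_of_mem hj, hK.card_eq t ht]
  have hn : t.erase j ∉ cut K A := by simp [hcon]
  rw [hK.mem_cut_iff hA] at hn
  refine propext ⟨fun h => ?_, fun h => ?_⟩
  · by_contra hcon
    exact hn ⟨h2, t, h, u, hu, hcon, erase_subset _ _, hsub⟩
  · by_contra hcon
    exact hn ⟨h2, u, h, t, ht, hcon, hsub, erase_subset _ _⟩

theorem edges_filter_subset {t : Finset ι} (ht : t ∈ K) :
    {e ∈ edges K | e ⊆ t} = powersetCard 2 t := by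
  ext e
  simp only [mem_filter, mem_powersetCard]
  exact ⟨fun h => ⟨h.2, card_of_mem_edges h.1⟩, fun h => ⟨mem_edges_of_subset ht h.1 h.2, h.1⟩⟩

theorem card_edges_filter_mem (hK : IsSimpleSphere K) {t : Finset ι} (ht : t ∈ K) {i : ι}
    (hi : i ∈ t) : #{e ∈ edges K | i ∈ e ∧ e ⊆ t} = 2 := by
  have : {e ∈ edges K | i ∈ e ∧ e ⊆ t} = (t.erase i).image (fun j => t.erase j) := by
    ext e
    simp only [mem_filter, mem_image, mem_erase]
    constructor
    · rintro ⟨he, hie, het⟩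
      obtain ⟨j, hj, rfl⟩ := hK.exists_eq_erase ht het (card_of_mem_edges he)
      exact ⟨j, ⟨(mem_erase.1 hie).1.symm, hj⟩, rfl⟩
    · rintro ⟨j, ⟨hji, hj⟩, rfl⟩
      exact ⟨hK.erase_mem_edges ht hj, mem_erase.2 ⟨hji.symm, hi⟩, erase_subset _ _⟩
  rw [this, card_image_of_injOn, card_erase_of_mem hi, hK.card_eq t ht]
  intro a ha b hb hab
  simp only [coe_erase, Set.mem_sdiff, mem_coe] at ha hb
  by_contra hne
  have : a ∈ t.erase b := mem_erase.2 ⟨hne, ha.1⟩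
  simp [← show t.erase a = t.erase b from hab] at this

theorem sum_edges_card (hK : IsSimpleSphere K) (hA : A ⊆ K) :
    ∑ e ∈ edges K, #{t ∈ A | e ⊆ t} = 3 * #A := by
  have := sum_card_bipartiteAbove_eq_sum_card_bipartiteBelow (s := edges K) (t := A)
    (fun e t => e ⊆ t)
  simp only [bipartiteAbove, bipartiteBelow] at this
  rw [this, sum_congr rfl (g := fun _ => 3), sum_const, smul_eq_mul, mul_comm]
  intro t ht
  rw [edges_filter_subset (hA ht), card_powersetCard, hK.card_eq t (hA ht)]
  rfl

theorem sum_edges_card_mem (hK : IsSimpleSphere K) (hA : A ⊆ K) (i : ι) :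
    ∑ e ∈ edges K with i ∈ e, #{t ∈ A | e ⊆ t} = 2 * #{t ∈ A | i ∈ t} := by
  have := sum_card_bipartiteAbove_eq_sum_card_bipartiteBelow (s := {e ∈ edges K | i ∈ e}) (t := A)
    (fun e t => e ⊆ t)
  simp only [bipartiteAbove, bipartiteBelow, filter_filter] at this
  rw [this, card_filter, mul_sum]
  refine sum_congr rfl fun t ht => ?_
  split_ifs with hi
  · rw [hK.card_edges_filter_mem (hA ht) hi, mul_one]
  · simp only [mul_zero, card_eq_zero, filter_eq_empty_iff, not_and]
    exact fun e _ hie het => hi (het hie)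

theorem card_filter_subset_eq_ite (hK : IsSimpleSphere K) (hA : A ⊆ K) {e : Finset ι}
    (he : e ∈ edges K) : #{t ∈ A | e ⊆ t} =
      2 * (if e ∈ innerEdges K A then 1 else 0) + (if e ∈ cut K A then 1 else 0) := by
  have := hK.card_filter_subset_add hA he
  simp only [innerEdges, cut, mem_filter, he, true_and]
  split_ifs <;> omega

theorem two_mul_card_innerEdges (hK : IsSimpleSphere K) (hA : A ⊆ K) :
    2 * #(innerEdges K A) + #(cut K A) = 3 * #A := by
  rw [← hK.sum_edges_card hA, sum_congr rfl fun e he => hK.card_filter_subset_eq_ite hA he,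
    sum_add_distrib, ← mul_sum, sum_boole, sum_boole]
  simp only [Nat.cast_id]
  congr 3
  · ext e
    simp [innerEdges]
  · ext e
    simp [cut]

/-- Count the ends in `A` of the edges of facet `i`: every vertex of the facet is counted twice, an
inner edge contributes 2 and a cut edge 1. -/
theorem even_card_cut_filter (hK : IsSimpleSphere K) (hA : A ⊆ K) (i : ι) :
    Even #{e ∈ cut K A | i ∈ e} := by
  have := hK.sum_edges_card_mem hA i
  rw [sum_congr rfl fun e he => hK.card_filter_subset_eq_ite hA (mem_filter.1 he).1,
    sum_add_distrib, ← mul_sum, sum_boole, sum_boole] at this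
  simp only [Nat.cast_id] at this
  have h1 : {e ∈ {e ∈ edges K | i ∈ e} | e ∈ cut K A} = {e ∈ cut K A | i ∈ e} := by
    ext e
    simp only [cut, mem_filter]
    tauto
  rw [h1] at this
  exact ⟨#{t ∈ A | i ∈ t} - #{e ∈ {e ∈ edges K | i ∈ e} | e ∈ innerEdges K A}, by omega⟩

theorem card_edges_mem_eq_degree (hK : IsSimpleSphere K) (i : ι) :
    #{e ∈ edges K | i ∈ e} = degree K i := by
  have := hK.sum_edges_card_mem Subset.rfl i
  rw [sum_congr rfl (g := fun _ => 2), sum_const, smul_eq_mul] at this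
  · rw [degree]
    omega
  · intro e he
    exact hK.card_filter_subset (mem_filter.1 he).1

end IsSimpleSphere

/-! ### Sets of pairs meeting every point evenly -/

section EvenPairs

variable {ι : Type*} [DecidableEq ι] {C : Finset (Finset ι)}

/-- A walk along pairs never gets stuck: having entered `b` through one pair, evenness supplies
another to leave by. -/
theorem exists_pair_of_even (hC : ∀ e ∈ C, #e = 2) (hev : ∀ i, Even #{e ∈ C | i ∈ e}) {a b : ι}
    (hab : {a, b} ∈ C) : ∃ c, c ≠ a ∧ c ≠ b ∧ {b, c} ∈ C := by
  have hmem : ({a, b} : Finset ι) ∈ {e ∈ C | b ∈ e} := by simp [hab]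
  have h1 : 1 < #{e ∈ C | b ∈ e} := by
    have h0 : 0 < #{e ∈ C | b ∈ e} := card_pos.2 ⟨_, hmem⟩
    obtain ⟨r, hr⟩ := hev b
    omega
  obtain ⟨e, he, hne⟩ := exists_mem_ne h1 {a, b}
  rw [mem_filter] at he
  have h2 := hC e he.1
  have h3 : #(e.erase b) = 1 := by rw [card_erase_of_mem he.2, h2]
  obtain ⟨c, hc⟩ := card_eq_one.1 h3
  have hcb : c ∈ e.erase b := by simp [hc]
  have hec : e = {b, c} := by rw [← insert_erase he.2, hc]
  refine ⟨c, ?_, (mem_erase.1 hcb).1, hec ▸ he.1⟩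
  rintro rfl
  exact hne (by rw [hec, pair_comm])

theorem three_le_card_of_even (hC : ∀ e ∈ C, #e = 2) (hev : ∀ i, Even #{e ∈ C | i ∈ e})
    (hne : C.Nonempty) : 3 ≤ #C := by
  obtain ⟨e, he⟩ := hne
  obtain ⟨a, b, hab, rfl⟩ := card_eq_two.1 (hC e he)
  obtain ⟨c, hca, hcb, hbc⟩ := exists_pair_of_even hC hev he
  obtain ⟨d, hdb, hdc, hcd⟩ := exists_pair_of_even hC hev hbc
  have : #({{a, b}, {b, c}, {c, d}} : Finset (Finset ι)) = 3 := by
    refine card_eq_three.2 ⟨_, _, _, ?_, ?_, ?_, rfl⟩ <;> intro h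
    · have : c ∈ ({a, b} : Finset ι) := by rw [h]; simp
      simp [hca, hcb] at this
    · have : c ∈ ({a, b} : Finset ι) := by rw [h]; simp
      simp [hca, hcb] at this
    · have : d ∈ ({b, c} : Finset ι) := by rw [h]; simp
      simp [hdc, hdb] at this
  rw [← this]
  refine card_le_card fun x hx => ?_
  simp only [mem_insert, mem_singleton] at hx
  rcases hx with rfl | rfl | rfl <;> assumption

theorem exists_triangle_of_even (hC : ∀ e ∈ C, #e = 2) (hev : ∀ i, Even #{e ∈ C | i ∈ e})
    (h3 : #C = 3) : ∃ a b c, a ≠ b ∧ b ≠ c ∧ c ≠ a ∧ C = {{a, b}, {b, c}, {c, a}} := by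
  obtain ⟨e, he⟩ := card_pos.1 (by omega : 0 < #C)
  obtain ⟨a, b, hab, rfl⟩ := card_eq_two.1 (hC e he)
  obtain ⟨c, hca, hcb, hbc⟩ := exists_pair_of_even hC hev he
  obtain ⟨d, hdb, hdc, hcd⟩ := exists_pair_of_even hC hev hbc
  obtain ⟨x, hxb, hxa, hax⟩ := exists_pair_of_even hC hev (pair_comm a b ▸ he)
  have h3' : #({{a, b}, {b, c}, {c, d}} : Finset (Finset ι)) = 3 := by
    refine card_eq_three.2 ⟨_, _, _, ?_, ?_, ?_, rfl⟩ <;> intro h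
    · have : c ∈ ({a, b} : Finset ι) := by rw [h]; simp
      simp [hca, hcb] at this
    · have : c ∈ ({a, b} : Finset ι) := by rw [h]; simp
      simp [hca, hcb] at this
    · have : d ∈ ({b, c} : Finset ι) := by rw [h]; simp
      simp [hdc, hdb] at this
  have hEq : ({{a, b}, {b, c}, {c, d}} : Finset (Finset ι)) = C := by
    refine eq_of_subset_of_card_le (fun x hx => ?_) (by omega)
    simp only [mem_insert, mem_singleton] at hx
    rcases hx with rfl | rfl | rfl <;> assumption
  have hda : d = a := by
    rw [← hEq] at hax
    simp only [mem_insert, mem_singleton] at hax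
    rcases hax with h | h | h
    · have : x ∈ ({a, b} : Finset ι) := by rw [← h]; simp
      simp [hxa, hxb] at this
    · have : a ∈ ({b, c} : Finset ι) := by rw [← h]; simp
      simp [hab, hca.symm] at this
    · have : a ∈ ({c, d} : Finset ι) := by rw [← h]; simp
      simpa [hca.symm, eq_comm] using this
  subst hda
  exact ⟨d, b, c, hab, hcb.symm, hca, hEq.symm⟩

theorem exists_square_of_even (hC : ∀ e ∈ C, #e = 2) (hev : ∀ i, Even #{e ∈ C | i ∈ e})
    (h4 : #C = 4) : ∃ a b c d, [a, b, c, d].Nodup ∧ C = {{a, b}, {b, c}, {c, d}, {d, a}} := by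
  obtain ⟨e, he⟩ := card_pos.1 (by omega : 0 < #C)
  obtain ⟨a, b, hab, rfl⟩ := card_eq_two.1 (hC e he)
  obtain ⟨c, hca, hcb, hbc⟩ := exists_pair_of_even hC hev he
  obtain ⟨d, hdb, hdc, hcd⟩ := exists_pair_of_even hC hev hbc
  have h3' : #({{a, b}, {b, c}, {c, d}} : Finset (Finset ι)) = 3 := by
    refine card_eq_three.2 ⟨_, _, _, ?_, ?_, ?_, rfl⟩ <;> intro h
    · have : c ∈ ({a, b} : Finset ι) := by rw [h]; simp
      simp [hca, hcb] at this
    · have : c ∈ ({a, b} : Finset ι) := by rw [h]; simp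
      simp [hca, hcb] at this
    · have : d ∈ ({b, c} : Finset ι) := by rw [h]; simp
      simp [hdc, hdb] at this
  have hsub : ({{a, b}, {b, c}, {c, d}} : Finset (Finset ι)) ⊆ C := by
    intro x hx
    simp only [mem_insert, mem_singleton] at hx
    rcases hx with rfl | rfl | rfl <;> assumption
  have h1 : #(C \ {{a, b}, {b, c}, {c, d}}) = 1 := by rw [card_sdiff_of_subset hsub]; omega
  obtain ⟨f, hf⟩ := card_eq_one.1 h1
  have hfC : ∀ g, g ∈ C ↔ g = {a, b} ∨ g = {b, c} ∨ g = {c, d} ∨ g = f := by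
    intro g
    have := Finset.ext_iff.1 hf g
    simp only [mem_sdiff, mem_insert, mem_singleton] at this
    constructor
    · intro h
      tauto
    · rintro (rfl | rfl | rfl | rfl)
      exacts [he, hbc, hcd, (this.2 rfl).1]
  have hfn : f ≠ {a, b} ∧ f ≠ {b, c} ∧ f ≠ {c, d} := by
    have : f ∈ C \ {{a, b}, {b, c}, {c, d}} := by simp [hf]
    simp only [mem_sdiff, mem_insert, mem_singleton] at this
    tauto
  -- If the walk closed up after three pairs, each end of the fourth pair `f` would need a second
  -- pair, so both ends would lie on the triangle, all of whose pairs are already taken.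
  have hda : d ≠ a := by
    rintro rfl
    have hfc := hC f ((hfC f).2 (by simp))
    obtain ⟨x, y, hxy, rfl⟩ := card_eq_two.1 hfc
    have hx : ∀ x y, {x, y} ∈ C → ({x, y} : Finset ι) ≠ {d, b} → ({x, y} : Finset ι) ≠ {b, c} →
        ({x, y} : Finset ι) ≠ {c, d} → x = d ∨ x = b ∨ x = c := by
      intro x y hxyC h1 h2 h3
      obtain ⟨z, hzy, hzx, hzC⟩ := exists_pair_of_even hC hev (pair_comm x y ▸ hxyC)
      have hne : ({x, z} : Finset ι) ≠ {x, y} := by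
        intro h
        have : z ∈ ({x, y} : Finset ι) := by rw [← h]; simp
        simp [hzx, hzy] at this
      rcases (hfC _).1 hxyC with h | h | h | h
      · exact absurd h h1
      · exact absurd h h2
      · exact absurd h h3
      rw [← h] at hfC
      rcases (hfC _).1 hzC with h | h | h | h
      · have : x ∈ ({d, b} : Finset ι) := by rw [← h]; simp
        simp at this; tauto
      · have : x ∈ ({b, c} : Finset ι) := by rw [← h]; simp
        simp at this; tauto
      · have : x ∈ ({c, d} : Finset ι) := by rw [← h]; simp
        simp at this; tauto
      · exact absurd h hne
    have hfm : {x, y} ∈ C := (hfC _).2 (by simp)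
    have h1 := hx x y hfm hfn.1 hfn.2.1 hfn.2.2
    have h2 := hx y x (pair_comm x y ▸ hfm) (pair_comm x y ▸ hfn.1) (pair_comm x y ▸ hfn.2.1)
      (pair_comm x y ▸ hfn.2.2)
    obtain ⟨n1, n2, n3⟩ := hfn
    rcases h1 with rfl | rfl | rfl <;> rcases h2 with rfl | rfl | rfl <;>
      first
      | exact hxy rfl
      | exact n1 rfl
      | exact n2 rfl
      | exact n3 rfl
      | exact n1 (pair_comm _ _)
      | exact n2 (pair_comm _ _)
      | exact n3 (pair_comm _ _)
  obtain ⟨x, hxc, hxd, hdx⟩ := exists_pair_of_even hC hev hcd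
  obtain ⟨y, hyb, hya, hay⟩ := exists_pair_of_even hC hev (pair_comm a b ▸ he)
  have e1 : {d, x} = f := by
    rcases (hfC _).1 hdx with h | h | h | h
    · have : d ∈ ({a, b} : Finset ι) := by rw [← h]; simp
      simp [hda, hdb] at this
    · have : d ∈ ({b, c} : Finset ι) := by rw [← h]; simp
      simp [hdc, hdb] at this
    · have : x ∈ ({c, d} : Finset ι) := by rw [← h]; simp
      simp [hxc, hxd] at this
    · exact h
  have e2 : {a, y} = f := by
    rcases (hfC _).1 hay with h | h | h | h
    · have : y ∈ ({a, b} : Finset ι) := by rw [← h]; simp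
      simp [hya, hyb] at this
    · have : a ∈ ({b, c} : Finset ι) := by rw [← h]; simp
      simp [hab, hca.symm] at this
    · have : a ∈ ({c, d} : Finset ι) := by rw [← h]; simp
      simp [hca.symm, hda.symm] at this
    · exact h
  have hax : a = x := by
    have : a ∈ ({d, x} : Finset ι) := by rw [e1, ← e2]; simp
    simpa [hda.symm] using this
  refine ⟨a, b, c, d, ?_, ?_⟩
  · simp only [List.nodup_cons, List.mem_cons, List.not_mem_nil, or_false, not_or,
      not_false_eq_true, List.nodup_nil, and_true]
    exact ⟨⟨hab, hca.symm, hda.symm⟩, ⟨hcb.symm, hdb.symm⟩, hdc.symm⟩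
  · ext g
    rw [hfC g, ← e1, ← hax]
    simp

end EvenPairs

/-! ### Two dimension counts -/

section DimensionCount

variable {F α β γ : Type*} [Field F] [Fintype α]

theorem Matrix.card_le_rank_add_one_of_ker_const (M : Matrix β α F)
    (hM : ∀ x, M.mulVec x = 0 → ∀ a b, x a = x b) : Fintype.card α ≤ M.rank + 1 := by
  have h := LinearMap.finrank_range_add_finrank_ker M.mulVecLin
  rw [Module.finrank_pi] at h
  have h1 : Module.finrank F (LinearMap.ker M.mulVecLin) ≤ 1 := by
    rcases isEmpty_or_nonempty α with hα | ⟨⟨a⟩⟩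
    · exact (Submodule.finrank_le _).trans (by rw [Module.finrank_pi]; simp)
    · have hne : (fun _ => 1 : α → F) ≠ 0 := fun h => one_ne_zero (congrFun h a)
      refine (Submodule.finrank_mono (t := F ∙ (fun _ => 1 : α → F)) ?_).trans
        (finrank_span_singleton hne).le
      intro x hx
      rw [Submodule.mem_span_singleton]
      refine ⟨x a, ?_⟩
      ext b
      simp [hM x (by simpa using hx) a b]
  rw [Matrix.rank]
  omega

/-- A complex `Fᵅ → Fᵝ → Fᵞ` with one-dimensional ends is exact if its Euler characteristic is
large enough. -/
theorem Matrix.exists_mulVec_eq_of_card_le [Fintype β] [Fintype γ] (M : Matrix β α F)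
    (N : Matrix γ β F)
    (hNM : ∀ x, N.mulVec (M.mulVec x) = 0)
    (hM : ∀ x, M.mulVec x = 0 → ∀ a b, x a = x b)
    (hN : ∀ y, N.transpose.mulVec y = 0 → ∀ a b, y a = y b)
    (hcard : Fintype.card β + 2 ≤ Fintype.card α + Fintype.card γ)
    {g : β → F} (hg : N.mulVec g = 0) : ∃ x, M.mulVec x = g := by
  have h1 := M.card_le_rank_add_one_of_ker_const hM
  have h2 := N.transpose.card_le_rank_add_one_of_ker_const hN
  rw [Matrix.rank_transpose] at h2
  have h3 := LinearMap.finrank_range_add_finrank_ker N.mulVecLin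
  rw [Module.finrank_pi] at h3
  rw [Matrix.rank] at h1 h2
  have hle : LinearMap.range M.mulVecLin ≤ LinearMap.ker N.mulVecLin := by
    rintro _ ⟨x, rfl⟩
    simpa using hNM x
  -- The kernel of `N` has dimension at most |β| - |γ| + 1, the range of `M` at least |α| - 1, and
  -- `hcard` compares the two.
  have heq := Submodule.eq_of_le_of_finrank_le hle (by omega)
  have : g ∈ LinearMap.range M.mulVecLin := by
    rw [heq]
    simpa using hg
  obtain ⟨x, hx⟩ := this
  exact ⟨x, by simpa using hx⟩

/-- The ranks of two composable maps with zero composite add up to at most |β|; here they are at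
least |α| - 1 and exactly |γ|. -/
theorem Matrix.card_add_card_le_of_mul_eq_zero [Fintype β] [Fintype γ] (M : Matrix β α F)
    (N : Matrix γ β F)
    (hNM : ∀ x, N.mulVec (M.mulVec x) = 0)
    (hM : ∀ x, M.mulVec x = 0 → ∀ a b, x a = x b)
    (hN : ∀ y, N.transpose.mulVec y = 0 → y = 0) :
    Fintype.card α + Fintype.card γ ≤ Fintype.card β + 1 := by
  have h1 := M.card_le_rank_add_one_of_ker_const hM
  have h2 := LinearMap.finrank_range_add_finrank_ker N.transpose.mulVecLin
  have h2' : LinearMap.ker N.transpose.mulVecLin = ⊥ := by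
    rw [LinearMap.ker_eq_bot']
    intro y hy
    exact hN y hy
  rw [h2', finrank_bot, Module.finrank_pi] at h2
  have h4 : N.transpose.rank = Fintype.card γ := by
    rw [Matrix.rank]
    omega
  rw [Matrix.rank_transpose] at h4
  have h3 := LinearMap.finrank_range_add_finrank_ker N.mulVecLin
  rw [Module.finrank_pi] at h3
  rw [Matrix.rank] at h1 h4
  have hle : LinearMap.range M.mulVecLin ≤ LinearMap.ker N.mulVecLin := by
    rintro _ ⟨x, rfl⟩
    simpa using hNM x
  have := Submodule.finrank_mono hle
  omega

end DimensionCount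

/-! ### The Jordan curve theorem mod 2 -/

namespace FacetTriples

variable {ι : Type*} [DecidableEq ι]

/-- The mod `2` incidence matrix between the members of `X` and the members of `Y` containing
them. -/
def incidence (X Y : Finset (Finset ι)) : Matrix X Y (ZMod 2) :=
  Matrix.of fun e t => if (e : Finset ι) ⊆ t then 1 else 0

theorem incidence_mulVec (X Y : Finset (Finset ι)) (f : Finset ι → ZMod 2) (e : X) :
    (incidence X Y).mulVec (fun t => f t) e = ∑ t ∈ Y with (e : Finset ι) ⊆ t, f t := by
  simp only [Matrix.mulVec, dotProduct, incidence, Matrix.of_apply, ite_mul, one_mul, zero_mul]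
  rw [sum_coe_sort Y (fun t => if (e : Finset ι) ⊆ t then f t else 0), sum_filter]

/-- Lets vectors indexed by a subtype be handled as functions on the whole type. The vanishing off
`Y` serves in `card_innerFacets_le`. -/
theorem exists_extend {α β : Type*} [DecidableEq α] [Zero β] (Y : Finset α) (x : Y → β) :
    ∃ f : α → β, (x = fun t : Y => f t) ∧ ∀ a ∉ Y, f a = 0 :=
  ⟨fun a => if h : a ∈ Y then x ⟨a, h⟩ else 0, by ext t; simp, fun a ha => by simp [ha]⟩

end FacetTriples

namespace IsSimpleSphere

variable {ι : Type*} [DecidableEq ι] {K A : Finset (Finset ι)}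

theorem filter_subset_eq_pair (hK : IsSimpleSphere K) {e t u : Finset ι} (h2 : #e = 2) (ht : t ∈ K)
    (hu : u ∈ K) (het : e ⊆ t) (heu : e ⊆ u) (hne : t ≠ u) : {s ∈ K | e ⊆ s} = {t, u} := by
  symm
  refine eq_of_subset_of_card_le ?_ ?_
  · intro x hx
    simp only [mem_insert, mem_singleton] at hx
    rcases hx with rfl | rfl <;> simp [*]
  · rw [hK.card_filter_subset (mem_edges_of_subset ht het h2), card_pair hne]

theorem eq_of_sum_edge (hK : IsSimpleSphere K) {f : Finset ι → ZMod 2} {e t u : Finset ι}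
    (h2 : #e = 2) (ht : t ∈ K) (hu : u ∈ K) (het : e ⊆ t) (heu : e ⊆ u)
    (hsum : ∑ s ∈ K with e ⊆ s, f s = 0) : f t = f u := by
  by_cases hne : t = u
  · rw [hne]
  · rw [hK.filter_subset_eq_pair h2 ht hu het heu hne, sum_pair hne] at hsum
    exact CharTwo.add_eq_zero.1 hsum

/-- Functions on facets that agree on adjacent facets are constant. -/
theorem facet_eq_of_adj (hK : IsSimpleSphere K) {α : Type*} (y : ι → α)
    (hy : ∀ i j, i ≠ j → {i, j} ∈ edges K → y i = y j) (i j : ι) : y i = y j := by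
  classical
  have hy' : ∀ t ∈ K, ∀ a ∈ t, ∀ b ∈ t, y a = y b := by
    intro t ht a ha b hb
    by_cases hab : a = b
    · rw [hab]
    · refine hy a b hab (mem_edges_of_subset ht ?_ (card_pair hab))
      intro x hx
      simp only [mem_insert, mem_singleton] at hx
      rcases hx with rfl | rfl <;> assumption
  have hne : ∀ t ∈ K, t.Nonempty := fun t ht => card_pos.1 (by rw [hK.card_eq t ht]; omega)
  obtain ⟨t, ht, hit⟩ := hK.cover i
  obtain ⟨u, hu, hju⟩ := hK.cover j
  have := hK.eq_of_adj ∅ (fun t => t.image y) ?_ ht hu (by simp) (by simp)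
  · have h1 : y i ∈ t.image y := mem_image_of_mem _ hit
    rw [show t.image y = u.image y from this] at h1
    obtain ⟨k, hk, hki⟩ := mem_image.1 h1
    rw [← hki, hy' u hu k hk j hju]
  · intro t ht u hu k hk hsub _
    have hc : ∀ t ∈ K, ∀ a ∈ t, t.image y = {y a} := by
      intro t ht a ha
      ext z
      simp only [mem_image, mem_singleton]
      constructor
      · rintro ⟨b, hb, rfl⟩
        exact hy' t ht b hb a ha
      · rintro rfl
        exact ⟨a, ha, rfl⟩
    have h2 : 0 < #(t.erase k) := by rw [card_erase_of_mem hk, hK.card_eq t ht]; omega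
    obtain ⟨a, ha⟩ := card_pos.1 h2
    rw [hc t ht a (mem_of_mem_erase ha), hc u hu a (hsub ha)]

/-- Every set of edges that meets each facet evenly is a cut. -/
theorem exists_cut_eq [Fintype ι] [Nonempty ι] (hK : IsSimpleSphere K) {C : Finset (Finset ι)}
    (hC : C ⊆ edges K) (hev : ∀ i, Even #{e ∈ C | i ∈ e}) : ∃ A ⊆ K, cut K A = C := by
  classical
  let N : Matrix ι (edges K) (ZMod 2) := Matrix.of fun i e => if i ∈ (e : Finset ι) then 1 else 0
  have hNv : ∀ (f : Finset ι → ZMod 2) (i : ι),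
      N.mulVec (fun e => f e) i = ∑ e ∈ edges K with i ∈ e, f e := by
    intro f i
    simp only [N, Matrix.mulVec, dotProduct, Matrix.of_apply, ite_mul, one_mul, zero_mul]
    rw [sum_coe_sort (edges K) (fun e => if i ∈ e then f e else 0), sum_filter]
  have h2K := hK.two_mul_card_innerEdges Subset.rfl
  have hin : innerEdges K K = edges K := filter_true_of_mem fun e he => hK.card_filter_subset he
  have hcut : cut K K = ∅ := by
    rw [cut, filter_eq_empty_iff]
    intro e he
    rw [hK.card_filter_subset he]
    omega
  rw [hin, hcut, card_empty] at h2K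
  have heuler := hK.card_add_four_le
  -- Exactness in the middle of the complex vertices → edges → facets over the field with two
  -- elements. The composite vanishes because a facet has two edges at each of its vertices,
  -- connectedness makes both end kernels constant, and the cardinality condition is Euler's
  -- inequality since 2 #edges = 3 #K.
  have hex : ∃ x, (incidence (edges K) K).mulVec x =
      fun e : edges K => if (e : Finset ι) ∈ C then (1 : ZMod 2) else 0 := by
    refine Matrix.exists_mulVec_eq_of_card_le (incidence (edges K) K) N ?_ ?_ ?_ ?_ ?_
    · intro x
      obtain ⟨f, rfl, -⟩ := exists_extend K x
      ext i
      have : (incidence (edges K) K).mulVec (fun t => f t) =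
          fun e : edges K => ∑ t ∈ K with (e : Finset ι) ⊆ t, f t := by
        ext e
        exact incidence_mulVec _ _ _ _
      rw [this, hNv (fun e => ∑ t ∈ K with e ⊆ t, f t) i]
      simp only [sum_filter, Pi.zero_apply]
      rw [← sum_filter, sum_comm]
      refine sum_eq_zero fun t ht => ?_
      rw [← sum_filter, filter_filter, sum_const]
      by_cases hi : i ∈ t
      · rw [hK.card_edges_filter_mem ht hi, two_nsmul, CharTwo.add_self_eq_zero]
      · rw [filter_false_of_mem, card_empty, zero_nsmul]
        exact fun e _ h => hi (h.2 h.1)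
    · intro x hx
      obtain ⟨f, rfl, -⟩ := exists_extend K x
      intro a b
      refine hK.eq_of_adj ∅ f ?_ a.2 b.2 (by simp) (by simp)
      intro t ht u hu j hj hsub _
      have he := hK.erase_mem_edges ht hj
      refine hK.eq_of_sum_edge (card_of_mem_edges he) ht hu (erase_subset _ _) hsub ?_
      have := congrFun hx ⟨_, he⟩
      rwa [incidence_mulVec] at this
    · intro y hy i j
      refine hK.facet_eq_of_adj y ?_ i j
      intro i j hij he
      have := congrFun hy ⟨_, he⟩
      simp only [N, Matrix.mulVec, dotProduct, Matrix.transpose_apply, Matrix.of_apply, ite_mul,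
        one_mul, zero_mul, Pi.zero_apply] at this
      rw [← sum_filter, show ({a | a ∈ ({i, j} : Finset ι)} : Finset ι) = {i, j} by ext; simp,
        sum_pair hij] at this
      exact CharTwo.add_eq_zero.1 this
    · simp only [Fintype.card_coe]
      omega
    · ext i
      rw [hNv (fun e => if e ∈ C then 1 else 0) i, sum_boole, filter_filter]
      have : {e ∈ edges K | i ∈ e ∧ e ∈ C} = {e ∈ C | i ∈ e} := by
        ext e
        simp only [mem_filter]
        exact ⟨fun h => ⟨h.2.2, h.2.1⟩, fun h => ⟨hC h.1, h.2, h.1⟩⟩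
      rw [this, Pi.zero_apply]
      exact (ZMod.natCast_eq_zero_iff_even).2 (hev i)
  obtain ⟨x, hx⟩ := hex
  obtain ⟨f, rfl, -⟩ := exists_extend K x
  have h01 : ∀ z : ZMod 2, z = if z = 1 then 1 else 0 := by decide
  have hfe : ∀ e ∈ edges K, ((#{t ∈ {t ∈ K | f t = 1} | e ⊆ t} : ℕ) : ZMod 2) =
      if e ∈ C then 1 else 0 := by
    intro e he
    have h := congrFun hx ⟨e, he⟩
    rw [incidence_mulVec] at h
    simp only at h
    rw [← h, filter_filter, filter_congr (fun t _ => and_comm), ← filter_filter, ← sum_boole]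
    exact sum_congr rfl fun t _ => (h01 _).symm
  -- The primitive `f` is the indicator of the side. An edge has at most two ends in it, so an odd
  -- number of ends means exactly one.
  refine ⟨{t ∈ K | f t = 1}, filter_subset _ _, ?_⟩
  ext e
  constructor
  · intro h
    obtain ⟨he, h1⟩ := mem_filter.1 h
    have := hfe e he
    rw [h1] at this
    by_contra hcon
    simp [hcon] at this
  · intro h
    have he := hC h
    refine mem_filter.2 ⟨he, ?_⟩
    have h3 := hfe e he
    have h4 := hK.card_filter_subset_add (filter_subset (fun t => f t = 1) K) he
    rw [if_pos h] at h3
    have h5 : #{t ∈ {t ∈ K | f t = 1} | e ⊆ t} ≤ 2 := by omega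
    interval_cases hc : #{t ∈ {t ∈ K | f t = 1} | e ⊆ t}
    · simp at h3
    · rfl
    · exact absurd h3 (by decide)

theorem three_le_card_cut (hK : IsSimpleSphere K) (hA : A ⊆ K) (h0 : A.Nonempty) (h1 : A ≠ K) :
    3 ≤ #(cut K A) :=
  three_le_card_of_even (fun _ he => card_of_mem_edges (cut_subset _ _ he))
    (hK.even_card_cut_filter hA) (hK.cut_nonempty hA h0 h1)

/-- The side of a cut with at most five edges is connected. -/
theorem eq_of_innerEdges (hK : IsSimpleSphere K) (hA : A ⊆ K) (h1 : A ≠ K)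
    (h5 : #(cut K A) ≤ 5) {α : Type*} (f : Finset ι → α)
    (hf : ∀ t ∈ A, ∀ u ∈ A, ∀ e ∈ edges K, e ⊆ t → e ⊆ u → f t = f u)
    {a b : Finset ι} (ha : a ∈ A) (hb : b ∈ A) : f a = f b := by
  classical
  by_contra hab
  -- If `B` is a union of level sets of `f` in `A`, its cut edges all leave `A`. Thus a level set
  -- and its complement in `A` have disjoint cuts inside `cut K A`; each has at least 3 edges,
  -- against the bound 5.
  have key : ∀ B ⊆ A, (∀ t ∈ B, ∀ u ∈ A, f t = f u → u ∈ B) → ∀ e ∈ cut K B,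
      (∃ t ∈ B, e ⊆ t) ∧ ∃ u ∈ K, u ∉ A ∧ e ⊆ u := by
    intro B hB hBf e he
    obtain ⟨h2, t, ht, u, hu, huB, het, heu⟩ := (hK.mem_cut_iff (hB.trans hA)).1 he
    refine ⟨⟨t, ht, het⟩, u, hu, fun huA => huB ?_, heu⟩
    exact hBf t ht u huA (hf t (hB ht) u huA e (mem_edges_of_subset hu heu h2) het heu)
  set B := {t ∈ A | f t = f a} with hBdef
  have hB : B ⊆ A := filter_subset _ _
  have kB := key B hB fun t ht u hu h => mem_filter.2 ⟨hu, h ▸ (mem_filter.1 ht).2⟩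
  have kC := key (A \ B) sdiff_subset fun t ht u hu h => by
    rw [mem_sdiff] at ht ⊢
    refine ⟨hu, fun huB => ht.2 (mem_filter.2 ⟨ht.1, ?_⟩)⟩
    rw [h, (mem_filter.1 huB).2]
  have hAK : ∀ D ⊆ A, D ≠ K := by
    rintro D hD rfl
    exact h1 (Subset.antisymm hA hD)
  have c1 := hK.three_le_card_cut (hB.trans hA) ⟨a, mem_filter.2 ⟨ha, rfl⟩⟩ (hAK B hB)
  have c2 := hK.three_le_card_cut (sdiff_subset.trans hA)
    ⟨b, mem_sdiff.2 ⟨hb, fun h => hab (mem_filter.1 h).2.symm⟩⟩ (hAK (A \ B) sdiff_subset)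
  have hdisj : Disjoint (cut K B) (cut K (A \ B)) := by
    rw [disjoint_left]
    intro e he he'
    obtain ⟨⟨t, ht, het⟩, u, hu, huA, heu⟩ := kB e he
    obtain ⟨⟨t', ht', het'⟩, -⟩ := kC e he'
    rw [mem_sdiff] at ht'
    have htu : t ≠ u := fun h => huA (h ▸ hB ht)
    rcases hK.eq_or_eq (card_of_mem_edges (cut_subset _ _ he)) (hA (hB ht)) hu (hA ht'.1) het heu
      het' htu with rfl | rfl
    exacts [ht'.2 ht, huA ht'.1]
  have hsub : cut K B ∪ cut K (A \ B) ⊆ cut K A := by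
    intro e he
    rcases mem_union.1 he with h | h
    · obtain ⟨⟨t, ht, het⟩, u, hu, huA, heu⟩ := kB e h
      exact (hK.mem_cut_iff hA).2
        ⟨card_of_mem_edges (cut_subset _ _ h), t, hB ht, u, hu, huA, het, heu⟩
    · obtain ⟨⟨t, ht, het⟩, u, hu, huA, heu⟩ := kC e h
      exact (hK.mem_cut_iff hA).2
        ⟨card_of_mem_edges (cut_subset _ _ h), t, sdiff_subset ht, u, hu, huA, het, heu⟩
  have := card_le_card hsub
  rw [card_union_of_disjoint hdisj] at this
  omega

/-- One half of Euler's formula for a side, from the complex vertices of `A` → inner edges → inner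
facets. Connectedness of the side controls the first kernel; the transpose of the second map is
injective because a function on inner facets extends by zero outside. -/
theorem card_innerFacets_le [Fintype ι] (hK : IsSimpleSphere K) (hA : A ⊆ K)
    (h1 : A ≠ K) (h5 : #(cut K A) ≤ 5) :
    #A + #(innerFacets K A) ≤ #(innerEdges K A) + 1 := by
  classical
  let E := innerEdges K A
  let D := innerFacets K A
  have hE : E ⊆ edges K := filter_subset _ _
  have hD : ∀ i ∈ D, ∀ t ∈ K, i ∈ t → t ∈ A := fun i hi => (mem_filter.1 hi).2
  have hDE : ∀ i ∈ D, ∀ e ∈ edges K, i ∈ e → e ∈ E := by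
    intro i hi e he hie
    refine mem_filter.2 ⟨he, ?_⟩
    rw [← hK.card_filter_subset he]
    congr 1
    ext t
    simp only [mem_filter]
    exact ⟨fun h => ⟨hA h.1, h.2⟩, fun h => ⟨hD i hi t h.1 (h.2 hie), h.2⟩⟩
  have hEK : ∀ e ∈ E, ∀ f : Finset ι → ZMod 2,
      ∑ t ∈ A with e ⊆ t, f t = ∑ t ∈ K with e ⊆ t, f t := by
    intro e he f
    obtain ⟨he, hc⟩ := mem_filter.1 he
    congr 1
    refine eq_of_subset_of_card_le (filter_subset_filter _ hA) ?_
    rw [hc, hK.card_filter_subset he]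
  let N : Matrix D E (ZMod 2) := Matrix.of fun i e => if (i : ι) ∈ (e : Finset ι) then 1 else 0
  have := Matrix.card_add_card_le_of_mul_eq_zero (incidence E A) N ?_ ?_ ?_
  · simpa only [Fintype.card_coe] using this
  · intro x
    obtain ⟨f, rfl, -⟩ := exists_extend A x
    ext i
    have : (incidence E A).mulVec (fun t => f t) =
        fun e : E => ∑ t ∈ A with (e : Finset ι) ⊆ t, f t := by
      ext e
      exact incidence_mulVec _ _ _ _
    rw [this]
    simp only [N, Matrix.mulVec, dotProduct, Matrix.of_apply, ite_mul, one_mul, zero_mul]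
    rw [sum_coe_sort E (fun e => if (i : ι) ∈ e then ∑ t ∈ A with e ⊆ t, f t else 0),
      ← sum_filter]
    simp only [sum_filter, Pi.zero_apply]
    rw [← sum_filter, sum_comm]
    refine sum_eq_zero fun t ht => ?_
    rw [← sum_filter, filter_filter, sum_const]
    by_cases hi : (i : ι) ∈ t
    · have : {e ∈ E | (i : ι) ∈ e ∧ e ⊆ t} = {e ∈ edges K | (i : ι) ∈ e ∧ e ⊆ t} := by
        ext e
        simp only [mem_filter]
        exact ⟨fun h => ⟨hE h.1, h.2⟩, fun h => ⟨hDE i i.2 e h.1 h.2.1, h.2⟩⟩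
      rw [this, hK.card_edges_filter_mem (hA ht) hi, two_nsmul, CharTwo.add_self_eq_zero]
    · rw [filter_false_of_mem, card_empty, zero_nsmul]
      exact fun e _ h => hi (h.2 h.1)
  · intro x hx
    obtain ⟨f, rfl, -⟩ := exists_extend A x
    intro a b
    refine hK.eq_of_innerEdges hA h1 h5 f ?_ a.2 b.2
    intro t ht u hu e he het heu
    by_cases htu : t = u
    · rw [htu]
    have heE : e ∈ E := by
      refine mem_filter.2 ⟨he, ?_⟩
      have h2 : ({t, u} : Finset (Finset ι)) ⊆ {t ∈ A | e ⊆ t} := by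
        intro x hx
        simp only [mem_insert, mem_singleton] at hx
        rcases hx with rfl | rfl <;> simp [*]
      have h3 := card_le_card h2
      rw [card_pair htu] at h3
      have := hK.card_filter_subset_add hA he
      omega
    refine hK.eq_of_sum_edge (card_of_mem_edges he) (hA ht) (hA hu) het heu ?_
    have := congrFun hx ⟨_, heE⟩
    rwa [incidence_mulVec, hEK e heE] at this
  · intro y hy
    obtain ⟨g, rfl, hg⟩ := exists_extend D y
    -- An edge that is not inner lies on no inner facet, so both values are zero there. Hence `g` is
    -- constant on all facets, and it vanishes on a facet through a vertex outside `A`.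
    have hadj : ∀ i j, i ≠ j → {i, j} ∈ edges K → g i = g j := by
      intro i j hij he
      by_cases heE : {i, j} ∈ E
      · have := congrFun hy ⟨_, heE⟩
        simp only [N, Matrix.mulVec, dotProduct, Matrix.transpose_apply, Matrix.of_apply, ite_mul,
          one_mul, zero_mul, Pi.zero_apply] at this
        rw [sum_coe_sort D (fun k => if k ∈ ({i, j} : Finset ι) then g k else 0),
          sum_subset (subset_univ D) (fun k _ hk => by simp [hg k hk]), ← sum_filter,
          show ({a | a ∈ ({i, j} : Finset ι)} : Finset ι) = {i, j} by ext; simp,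
          sum_pair hij] at this
        exact CharTwo.add_eq_zero.1 this
      · rw [hg i fun h => heE (hDE i h _ he (by simp)), hg j fun h => heE (hDE j h _ he (by simp))]
    obtain ⟨u, hu, huA⟩ : ∃ u ∈ K, u ∉ A := by
      by_contra! h
      exact h1 (Subset.antisymm hA h)
    obtain ⟨k, hk⟩ := card_pos.1 (by rw [hK.card_eq u hu]; omega : 0 < #u)
    have hkD : k ∉ D := fun h => huA (hD k h u hu hk)
    ext i
    rw [hK.facet_eq_of_adj g hadj i k, hg k hkD]
    rfl

end IsSimpleSphere

/-! ### Sides of belts and their weights -/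

namespace FacetTriples

variable {ι : Type*} [DecidableEq ι]

/-- The set `A` of vertices is one of the two sides of a chordless cyclic sequence of facets. -/
structure BeltSide (K A : Finset (Finset ι)) : Prop where
  subset : A ⊆ K
  not_subset : ∀ t ∈ K, ¬ t ⊆ rim K A
  chordless : ∀ e ∈ edges K, e ⊆ rim K A → e ∈ cut K A

/-- The vertices of `A` that are not on the rim. -/
def core (K A : Finset (Finset ι)) : Finset (Finset ι) := {t ∈ A | #(t ∩ rim K A) = 0}

theorem core_subset (K A : Finset (Finset ι)) : core K A ⊆ A := filter_subset _ _

/-- All facets are pentagons and hexagons, except at most one, a quadrangle or a heptagon. -/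
structure PentHex (K : Finset (Finset ι)) : Prop where
  four_le : ∀ i, 4 ≤ degree K i
  le_seven : ∀ i, degree K i ≤ 7
  unique : ∀ i j, degree K i = 4 ∨ degree K i = 7 → degree K j = 4 ∨ degree K j = 7 → i = j

theorem innerFacets_mono [Fintype ι] {K A B : Finset (Finset ι)} (h : A ⊆ B) :
    innerFacets K A ⊆ innerFacets K B := by
  intro i hi
  simp only [innerFacets, mem_filter, mem_univ, true_and] at hi ⊢
  exact fun t ht hit => h (hi t ht hit)

/-- Only a quadrangle falls short of 5, by 1, and there is at most one. -/
theorem PentHex.five_mul_card_le {K : Finset (Finset ι)} (h : PentHex K) (D : Finset ι) :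
    5 * #D ≤ ∑ i ∈ D, degree K i + 1 := by
  by_cases hq : ∃ q ∈ D, degree K q = 4
  · obtain ⟨q, hqD, hq⟩ := hq
    rw [← add_sum_erase D _ hqD, hq]
    have : ∑ i ∈ D.erase q, 5 ≤ ∑ i ∈ D.erase q, degree K i := by
      refine sum_le_sum fun i hi => ?_
      have h1 := h.four_le i
      have h2 : degree K i ≠ 4 := fun h4 =>
        (mem_erase.1 hi).1 (h.unique i q (Or.inl h4) (Or.inl hq))
      omega
    rw [sum_const, smul_eq_mul, card_erase_of_mem hqD] at this
    have := card_pos.2 ⟨q, hqD⟩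
    omega
  · push Not at hq
    have : ∑ i ∈ D, 5 ≤ ∑ i ∈ D, degree K i := by
      refine sum_le_sum fun i hi => ?_
      have h1 := h.four_le i
      have h2 := hq i hi
      omega
    rw [sum_const, smul_eq_mul] at this
    omega

theorem PentHex.sum_degree_le {K : Finset (Finset ι)} (h : PentHex K) (D : Finset ι) :
    ∑ i ∈ D, degree K i ≤ 6 * #D + 1 := by
  by_cases hq : ∃ q ∈ D, degree K q = 7
  · obtain ⟨q, hqD, hq⟩ := hq
    rw [← add_sum_erase D _ hqD, hq]
    have : ∑ i ∈ D.erase q, degree K i ≤ ∑ i ∈ D.erase q, 6 := by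
      refine sum_le_sum fun i hi => ?_
      have h1 := h.le_seven i
      have h2 : degree K i ≠ 7 := fun h4 =>
        (mem_erase.1 hi).1 (h.unique i q (Or.inr h4) (Or.inr hq))
      omega
    rw [sum_const, smul_eq_mul, card_erase_of_mem hqD] at this
    have := card_pos.2 ⟨q, hqD⟩
    omega
  · push Not at hq
    have : ∑ i ∈ D, degree K i ≤ ∑ i ∈ D, 6 := by
      refine sum_le_sum fun i hi => ?_
      have h1 := h.le_seven i
      have h2 := hq i hi
      omega
    rw [sum_const, smul_eq_mul] at this
    omega

theorem sum_degree_le_of_forall {K : Finset (Finset ι)} {D : Finset ι}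
    (h : ∀ i ∈ D, degree K i ≤ 6) : ∑ i ∈ D, degree K i ≤ 6 * #D := by
  have := sum_le_sum h
  rw [sum_const, smul_eq_mul] at this
  omega

end FacetTriples

namespace IsSimpleSphere

variable {ι : Type*} [DecidableEq ι] {K A : Finset (Finset ι)}

/-- A rim facet lies on a positive even number of cut edges, hence on at least two, while each edge
lies on two facets. -/
theorem card_rim_le (hK : IsSimpleSphere K) (hA : A ⊆ K) : #(rim K A) ≤ #(cut K A) := by
  have h := sum_card_bipartiteAbove_eq_sum_card_bipartiteBelow (s := rim K A) (t := cut K A)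
    (fun i e => i ∈ e)
  simp only [bipartiteAbove, bipartiteBelow] at h
  have h1 : ∑ e ∈ cut K A, #{i ∈ rim K A | i ∈ e} = ∑ e ∈ cut K A, 2 := by
    refine sum_congr rfl fun e he => ?_
    rw [← card_of_mem_edges (cut_subset _ _ he)]
    congr 1
    ext i
    simp only [mem_filter, and_iff_right_iff_imp]
    exact fun hi => subset_rim he hi
  have h2 : ∑ i ∈ rim K A, 2 ≤ ∑ i ∈ rim K A, #{e ∈ cut K A | i ∈ e} := by
    refine sum_le_sum fun i hi => ?_
    obtain ⟨e, he, hie⟩ := mem_rim.1 hi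
    have hpos : 0 < #{e ∈ cut K A | i ∈ e} := card_pos.2 ⟨e, by simp [*]⟩
    obtain ⟨r, hr⟩ := hK.even_card_cut_filter hA i
    omega
  rw [h, h1] at h2
  simp only [sum_const, smul_eq_mul] at h2
  omega

theorem notMem_rim_of_mem_innerFacets [Fintype ι] (hK : IsSimpleSphere K) (hA : A ⊆ K) {i : ι}
    (hi : i ∈ innerFacets K A) : i ∉ rim K A := by
  intro h
  obtain ⟨e, he, hie⟩ := mem_rim.1 h
  obtain ⟨-, -, -, u, hu, huA, -, heu⟩ := (hK.mem_cut_iff hA).1 he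
  exact huA ((mem_filter.1 hi).2 u hu (heu hie))

theorem notMem_innerFacets_sdiff [Fintype ι] (hK : IsSimpleSphere K) {i : ι}
    (hi : i ∈ innerFacets K A) : i ∉ innerFacets K (K \ A) := by
  intro h
  obtain ⟨t, ht, hit⟩ := hK.cover i
  exact (mem_sdiff.1 ((mem_filter.1 h).2 t ht hit)).2 ((mem_filter.1 hi).2 t ht hit)

theorem mem_innerFacets_of_mem [Fintype ι] (hK : IsSimpleSphere K) (hA : A ⊆ K) {i : ι}
    (hi : i ∉ rim K A) {t : Finset ι} (ht : t ∈ A) (hit : i ∈ t) : i ∈ innerFacets K A := by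
  simp only [innerFacets, mem_filter, mem_univ, true_and]
  intro u hu hiu
  exact (hK.mem_iff_of_notMem_rim hA hi (hA ht) hu hit hiu).1 ht

theorem card_le_innerFacets_add [Fintype ι] (hK : IsSimpleSphere K) (hA : A ⊆ K) :
    Fintype.card ι ≤ #(innerFacets K A) + #(innerFacets K (K \ A)) + #(rim K A) := by
  rw [← card_univ]
  refine (card_le_card (t := innerFacets K A ∪ innerFacets K (K \ A) ∪ rim K A) ?_).trans
    ((card_union_le _ _).trans (Nat.add_le_add_right (card_union_le _ _) _))
  intro i _
  by_cases hi : i ∈ rim K A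
  · exact mem_union_right _ hi
  refine mem_union_left _ ?_
  obtain ⟨t, ht, hit⟩ := hK.cover i
  by_cases htA : t ∈ A
  · exact mem_union_left _ (hK.mem_innerFacets_of_mem hA hi htA hit)
  · refine mem_union_right _ (hK.mem_innerFacets_of_mem sdiff_subset ?_ (mem_sdiff.2 ⟨ht, htA⟩) hit)
    rwa [hK.rim_sdiff hA]

/-- Euler's formula for a side of a cut with at most five edges. -/
theorem two_mul_card_innerFacets [Fintype ι] [Nonempty ι] (hK : IsSimpleSphere K) (hA : A ⊆ K)
    (h0 : A.Nonempty) (h1 : A ≠ K) (h5 : #(cut K A) ≤ 5) :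
    2 * #(innerFacets K A) + #(cut K A) = #A + 2 := by
  -- The half formula for `A` and for `K \ A` bounds 2 #D + #cut from above on each side. Summed,
  -- the bounds meet Euler's inequality for `K` and `card_rim_le` from the other direction, so all
  -- are equalities.
  have a1 := hK.card_innerFacets_le hA h1 h5
  have a2 := hK.two_mul_card_innerEdges hA
  have hne : K \ A ≠ K := by
    intro h
    obtain ⟨t, ht⟩ := h0
    have : t ∈ K \ A := by rw [h]; exact hA ht
    exact (mem_sdiff.1 this).2 ht
  have b1 := hK.card_innerFacets_le (A := K \ A) sdiff_subset hne (by rwa [hK.cut_sdiff hA])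
  have b2 := hK.two_mul_card_innerEdges (A := K \ A) sdiff_subset
  rw [hK.cut_sdiff hA, card_sdiff_of_subset hA] at b2
  rw [card_sdiff_of_subset hA] at b1
  have c := hK.card_le_innerFacets_add hA
  have d := hK.card_rim_le hA
  have e := hK.card_add_four_le
  have := card_le_card hA
  omega

theorem weight_eq_sum (K A : Finset (Finset ι)) : weight K A = ∑ t ∈ A, #(t ∩ rim K A) := by
  have h := sum_card_bipartiteAbove_eq_sum_card_bipartiteBelow (s := rim K A) (t := A)
    (fun i t => i ∈ t)
  simp only [bipartiteAbove, bipartiteBelow] at h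
  rw [weight, h]
  refine sum_congr rfl fun t _ => ?_
  rw [filter_mem_eq_inter, inter_comm]

/-- Each vertex of `A` has three facets, and each of them is either on the rim or inner. -/
theorem sum_degree_add_weight [Fintype ι] (hK : IsSimpleSphere K) (hA : A ⊆ K) :
    ∑ i ∈ innerFacets K A, degree K i + weight K A = 3 * #A := by
  have h := sum_card_bipartiteAbove_eq_sum_card_bipartiteBelow (s := innerFacets K A) (t := A)
    (fun i t => i ∈ t)
  simp only [bipartiteAbove, bipartiteBelow] at h
  have h1 : ∑ i ∈ innerFacets K A, degree K i = ∑ i ∈ innerFacets K A, #{t ∈ A | i ∈ t} := by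
    refine sum_congr rfl fun i hi => ?_
    rw [degree]
    congr 1
    ext t
    simp only [mem_filter]
    exact ⟨fun h => ⟨(mem_filter.1 hi).2 t h.1 h.2, h.2⟩, fun h => ⟨hA h.1, h.2⟩⟩
  rw [h1, h, weight_eq_sum, ← sum_add_distrib, sum_congr rfl (g := fun _ => 3), sum_const,
    smul_eq_mul, mul_comm]
  intro t ht
  rw [filter_mem_eq_inter, inter_comm, ← card_union_of_disjoint, ← hK.card_eq t (hA ht),
    ← inter_union_distrib_left, inter_eq_left.2]
  · intro i hi
    by_cases hr : i ∈ rim K A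
    · exact mem_union_right _ hr
    · exact mem_union_left _ (hK.mem_innerFacets_of_mem hA hr ht hi)
  · refine disjoint_left.2 fun i hi hi' => ?_
    exact hK.notMem_rim_of_mem_innerFacets hA (mem_inter.1 hi).2 (mem_inter.1 hi').2

theorem weight_add_weight_sdiff (hK : IsSimpleSphere K) (hA : A ⊆ K) :
    weight K A + weight K (K \ A) = ∑ i ∈ rim K A, degree K i := by
  rw [weight, weight, hK.rim_sdiff hA, ← sum_add_distrib]
  refine sum_congr rfl fun i _ => ?_
  rw [degree, ← card_union_of_disjoint (disjoint_filter_filter disjoint_sdiff), ← filter_union,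
    union_sdiff_of_subset hA]

/-- Combining Euler's formula with `sum_degree_add_weight`, the weight is 3 #cut - 6 plus the sum of
6 - degree over the inner facets. With equal cuts, passing from `A` to `B` only discards nonnegative
terms. -/
theorem weight_mono [Fintype ι] [Nonempty ι] (hK : IsSimpleSphere K) {B : Finset (Finset ι)}
    (hA : A ⊆ K) (hBA : B ⊆ A) (h0 : B.Nonempty) (h1 : A ≠ K) (h5 : #(cut K A) ≤ 5)
    (hcut : #(cut K B) = #(cut K A)) (hdeg : ∀ i ∈ innerFacets K A, degree K i ≤ 6) :
    weight K B ≤ weight K A := by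
  have hBK : B ≠ K := by
    rintro rfl
    exact h1 (Subset.antisymm hA hBA)
  have a1 := hK.two_mul_card_innerFacets hA (h0.mono hBA) h1 h5
  have a2 := hK.two_mul_card_innerFacets (hBA.trans hA) h0 hBK (by omega)
  have b1 := hK.sum_degree_add_weight hA
  have b2 := hK.sum_degree_add_weight (hBA.trans hA)
  have hsub := innerFacets_mono (K := K) hBA
  have c := sum_sdiff hsub (f := degree K)
  have d := sum_degree_le_of_forall (K := K) (D := innerFacets K A \ innerFacets K B)
    fun i hi => hdeg i (mem_sdiff.1 hi).1
  rw [card_sdiff_of_subset hsub] at d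
  have := card_le_card hsub
  omega

theorem mem_cut_iff_of_ne (hK : IsSimpleSphere K) (hA : A ⊆ K) {e t u : Finset ι} (h2 : #e = 2)
    (ht : t ∈ K) (hu : u ∈ K) (het : e ⊆ t) (heu : e ⊆ u) (hne : t ≠ u) :
    e ∈ cut K A ↔ ¬ (t ∈ A ↔ u ∈ A) := by
  rw [hK.mem_cut_iff hA]
  constructor
  · rintro ⟨-, r, hr, s, hs, hsA, her, hes⟩
    rcases hK.eq_or_eq h2 ht hu (hA hr) het heu her hne with rfl | rfl <;>
      rcases hK.eq_or_eq h2 ht hu hs het heu hes hne with rfl | rfl <;> tauto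
  · intro h
    by_cases htA : t ∈ A
    · exact ⟨h2, t, htA, u, hu, by tauto, het, heu⟩
    · exact ⟨h2, u, by tauto, t, ht, htA, heu, het⟩

/-- Crossing an edge changes membership in `A` exactly when it changes membership in `B`, so
agreement of the two is constant on the connected graph. -/
theorem eq_or_eq_sdiff_of_cut_eq (hK : IsSimpleSphere K) {B : Finset (Finset ι)} (hA : A ⊆ K)
    (hB : B ⊆ K) (h : cut K A = cut K B) : A = B ∨ A = K \ B := by
  by_contra! hcon
  have key : ∀ t ∈ K, ∀ u ∈ K, (t ∈ A ↔ t ∈ B) = (u ∈ A ↔ u ∈ B) := by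
    intro t ht u hu
    refine hK.eq_of_adj ∅ (fun t => (t ∈ A ↔ t ∈ B)) ?_ ht hu (by simp) (by simp)
    intro t ht u hu j hj hsub _
    by_cases htu : t = u
    · rw [htu]
    have h2 := card_of_mem_edges (hK.erase_mem_edges ht hj)
    have h3 := hK.mem_cut_iff_of_ne hA h2 ht hu (erase_subset _ _) hsub htu
    have h4 := hK.mem_cut_iff_of_ne hB h2 ht hu (erase_subset _ _) hsub htu
    rw [h] at h3
    exact propext (by tauto)
  by_cases hall : ∀ t ∈ K, (t ∈ A ↔ t ∈ B)
  · exact hcon.1 (Finset.ext fun t => ⟨fun h => (hall t (hA h)).1 h, fun h => (hall t (hB h)).2 h⟩)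
  · push Not at hall
    obtain ⟨t, ht, htn⟩ := hall
    refine hcon.2 (Finset.ext fun u => ?_)
    rw [mem_sdiff]
    have : u ∈ K → ¬ (u ∈ A ↔ u ∈ B) := fun hu => by
      rw [← key t ht u hu]
      tauto
    have := @hA u
    tauto

theorem cut_singleton {t : Finset ι} (ht : t ∈ K) :
    cut K {t} = powersetCard 2 t := by
  rw [← edges_filter_subset ht]
  ext e
  simp only [cut, mem_filter, filter_singleton]
  refine and_congr_right fun _ => ?_
  split_ifs with h <;> simp [h]

end IsSimpleSphere

namespace FacetTriples

variable {ι : Type*} [DecidableEq ι] {K A : Finset (Finset ι)}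

theorem pairs_eq_powersetCard {a b c : ι} (hab : a ≠ b) (hbc : b ≠ c) (hca : c ≠ a) :
    ({{a, b}, {b, c}, {c, a}} : Finset (Finset ι)) = powersetCard 2 {a, b, c} := by
  have h3 : #({a, b, c} : Finset ι) = 3 := card_eq_three.2 ⟨a, b, c, hab, hca.symm, hbc, rfl⟩
  refine eq_of_subset_of_card_le ?_ ?_
  · intro e he
    rw [mem_powersetCard]
    simp only [mem_insert, mem_singleton] at he
    rcases he with rfl | rfl | rfl
    · exact ⟨by intro x; simp; tauto, card_pair hab⟩
    · exact ⟨by intro x; simp; tauto, card_pair hbc⟩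
    · exact ⟨by intro x; simp; tauto, card_pair hca⟩
  · rw [card_powersetCard, h3]
    refine (card_eq_three.2 ⟨_, _, _, ?_, ?_, ?_, rfl⟩).ge <;> intro h
    · have : a ∈ ({b, c} : Finset ι) := by rw [← h]; simp
      simp [hab, hca.symm] at this
    · have : b ∈ ({c, a} : Finset ι) := by rw [← h]; simp
      simp [hab.symm, hbc] at this
    · have : b ∈ ({c, a} : Finset ι) := by rw [← h]; simp
      simp [hab.symm, hbc] at this

theorem beltSide_of_triangle (hK : IsSimpleSphere K) (hA : A ⊆ K) {a b c : ι} (hab : a ≠ b)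
    (hbc : b ≠ c) (hca : c ≠ a) (hcut : cut K A = {{a, b}, {b, c}, {c, a}})
    (habc : {a, b, c} ∉ K) : BeltSide K A := by
  have hrim : rim K A = {a, b, c} := by
    rw [rim, hcut]
    ext x
    simp
    tauto
  have h3 : #({a, b, c} : Finset ι) = 3 := card_eq_three.2 ⟨a, b, c, hab, hca.symm, hbc, rfl⟩
  refine ⟨hA, fun t ht hsub => habc ?_, fun e he hsub => ?_⟩
  · rw [hrim] at hsub
    rwa [← eq_of_subset_of_card_le hsub (by rw [h3, hK.card_eq t ht])]
  · rw [hcut, pairs_eq_powersetCard hab hbc hca, mem_powersetCard, ← hrim]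
    exact ⟨hsub, card_of_mem_edges he⟩

theorem rim_eq_of_square {a b c d : ι} (hcut : cut K A = {{a, b}, {b, c}, {c, d}, {d, a}}) :
    rim K A = {a, b, c, d} := by
  rw [rim, hcut]
  ext x
  simp
  tauto

theorem beltSide_of_square (hK : IsSimpleSphere K) (hA : A ⊆ K) {a b c d : ι}
    (hcut : cut K A = {{a, b}, {b, c}, {c, d}, {d, a}})
    (hac : a ≠ c) (hbd : b ≠ d) (hacK : {a, c} ∉ edges K) (hbdK : {b, d} ∉ edges K) :
    BeltSide K A := by
  have hrim := rim_eq_of_square hcut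
  refine ⟨hA, fun t ht hsub => ?_, fun e he hsub => ?_⟩
  · rw [hrim] at hsub
    have hn1 : ¬ (a ∈ t ∧ c ∈ t) := fun h => hacK
      (mem_edges_of_subset ht (by intro x; simp; rintro (rfl | rfl) <;> tauto) (card_pair hac))
    have hn2 : ¬ (b ∈ t ∧ d ∈ t) := fun h => hbdK
      (mem_edges_of_subset ht (by intro x; simp; rintro (rfl | rfl) <;> tauto) (card_pair hbd))
    have h3 := hK.card_eq t ht
    -- A vertex contains at most one of `a`, `c` and at most one of `b`, `d`, too few for three
    -- facets.
    have : ∃ x y, t ⊆ {x, y} := by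
      have hm : ∀ x ∈ t, x = a ∨ x = b ∨ x = c ∨ x = d := fun x hx => by simpa using hsub hx
      by_cases ha : a ∈ t <;> by_cases hb : b ∈ t
      · refine ⟨a, b, fun x hx => ?_⟩
        rcases hm x hx with rfl | rfl | rfl | rfl <;> simp <;> tauto
      · refine ⟨a, d, fun x hx => ?_⟩
        rcases hm x hx with rfl | rfl | rfl | rfl <;> simp <;> tauto
      · refine ⟨c, b, fun x hx => ?_⟩
        rcases hm x hx with rfl | rfl | rfl | rfl <;> simp <;> tauto
      · refine ⟨c, d, fun x hx => ?_⟩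
        rcases hm x hx with rfl | rfl | rfl | rfl <;> simp <;> tauto
    obtain ⟨x, y, hxy⟩ := this
    have := (card_le_card hxy).trans card_le_two
    omega
  · rw [hrim] at hsub
    obtain ⟨x, y, hxy, rfl⟩ := card_eq_two.1 (card_of_mem_edges he)
    have hx : x = a ∨ x = b ∨ x = c ∨ x = d := by simpa using @hsub x (by simp)
    have hy : y = a ∨ y = b ∨ y = c ∨ y = d := by simpa using @hsub y (by simp)
    have hcaK : {c, a} ∉ edges K := by rwa [pair_comm]
    have hdbK : {d, b} ∉ edges K := by rwa [pair_comm]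
    rw [hcut]
    rcases hx with rfl | rfl | rfl | rfl <;> rcases hy with rfl | rfl | rfl | rfl <;>
      first
      | exact absurd rfl hxy
      | exact absurd he hacK
      | exact absurd he hbdK
      | exact absurd he hcaK
      | exact absurd he hdbK
      | (simp; done)
      | (rw [pair_comm x y]; simp)

namespace BeltSide

theorem sdiff (h : BeltSide K A) (hK : IsSimpleSphere K) : BeltSide K (K \ A) :=
  ⟨sdiff_subset, by rw [hK.rim_sdiff h.subset]; exact h.not_subset,
    by rw [hK.rim_sdiff h.subset, hK.cut_sdiff h.subset]; exact h.chordless⟩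

theorem card_inter_rim_le (h : BeltSide K A) (hK : IsSimpleSphere K) {t : Finset ι} (ht : t ∈ A) :
    #(t ∩ rim K A) ≤ 2 := by
  by_contra! hcon
  have : t ∩ rim K A = t := eq_of_subset_of_card_le inter_subset_left
    (by rw [hK.card_eq t (h.subset ht)]; omega)
  exact h.not_subset t (h.subset ht) (inter_eq_left.1 this)

/-- A cut edge has one end in `A`, and the third facet there is off the rim. Conversely, two rim
facets at a vertex of `A` share an edge, which is a cut edge by chordlessness. -/
theorem card_filter_inter_eq_two (h : BeltSide K A) (hK : IsSimpleSphere K) :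
    #{t ∈ A | #(t ∩ rim K A) = 2} = #(cut K A) := by
  refine card_nbij' (fun t => t ∩ rim K A)
    -- On a cut edge the filter is a singleton, so this union is its unique end in `A`.
    (fun e => ((A.filter (e ⊆ ·)).biUnion id)) ?_ ?_ ?_ ?_
  · intro t ht
    obtain ⟨ht, h2⟩ := mem_filter.1 ht
    exact h.chordless _ (mem_edges_of_subset (h.subset ht) inter_subset_left h2) inter_subset_right
  · intro e he
    have he' : e ∈ cut K A := he
    obtain ⟨t, ht⟩ := card_eq_one.1 (mem_filter.1 he').2
    have htm : t ∈ {t ∈ A | e ⊆ t} := by simp [ht]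
    simp only [ht, singleton_biUnion, id]
    obtain ⟨htA, het⟩ := mem_filter.1 htm
    refine mem_filter.2 ⟨htA, le_antisymm (h.card_inter_rim_le hK htA) ?_⟩
    rw [← card_of_mem_edges (cut_subset _ _ he')]
    exact card_le_card (subset_inter het (subset_rim he'))
  · intro t ht
    obtain ⟨ht, h2⟩ := mem_filter.1 ht
    have hc : t ∩ rim K A ∈ cut K A :=
      h.chordless _ (mem_edges_of_subset (h.subset ht) inter_subset_left h2) inter_subset_right
    obtain ⟨s, hs⟩ := card_eq_one.1 (mem_filter.1 hc).2
    have htm : t ∈ {s ∈ A | t ∩ rim K A ⊆ s} := mem_filter.2 ⟨ht, inter_subset_left⟩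
    have hts : t = s := by simpa [hs] using htm
    simp only [hs, singleton_biUnion, id]
    exact hts.symm
  · intro e he
    have he' : e ∈ cut K A := he
    obtain ⟨t, ht⟩ := card_eq_one.1 (mem_filter.1 he').2
    have htm : t ∈ {t ∈ A | e ⊆ t} := by simp [ht]
    simp only [ht, singleton_biUnion, id]
    obtain ⟨htA, het⟩ := mem_filter.1 htm
    symm
    refine eq_of_subset_of_card_le (subset_inter het (subset_rim he')) ?_
    rw [card_of_mem_edges (cut_subset _ _ he')]
    exact h.card_inter_rim_le hK htA

/-- An edge leaving the core is disjoint from the rim, so it cannot leave `A`. Its outer end `u`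
therefore has exactly one rim facet, and the edge is recovered as `u \ rim K A`. -/
theorem card_cut_core_le (h : BeltSide K A) (hK : IsSimpleSphere K) :
    #(cut K (core K A)) ≤ #{t ∈ A | #(t ∩ rim K A) = 1} := by
  refine (card_le_card ?_).trans (card_image_le (s := {t ∈ A | #(t ∩ rim K A) = 1})
    (f := fun t => t \ rim K A))
  intro e he
  obtain ⟨h2, t, ht, u, hu, huc, het, heu⟩ :=
    (hK.mem_cut_iff ((core_subset K A).trans h.subset)).1 he
  obtain ⟨htA, ht0⟩ := mem_filter.1 ht
  have hdis : Disjoint e (rim K A) := by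
    rw [card_eq_zero, ← disjoint_iff_inter_eq_empty] at ht0
    exact disjoint_of_subset_left het ht0
  have huA : u ∈ A := by
    by_contra huA
    have hcut : e ∈ cut K A := (hK.mem_cut_iff h.subset).2 ⟨h2, t, htA, u, hu, huA, het, heu⟩
    have := disjoint_self.1 (disjoint_of_subset_right (subset_rim hcut) hdis)
    simp only [bot_eq_empty] at this
    simp [this] at h2
  have hu0 : #(u ∩ rim K A) ≠ 0 := fun h0 => huc (mem_filter.2 ⟨huA, h0⟩)
  have hsub : e ⊆ u \ rim K A := subset_sdiff.2 ⟨heu, hdis⟩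
  have hc := card_le_card hsub
  have hadd := card_sdiff_add_card_inter u (rim K A)
  rw [hK.card_eq u hu] at hadd
  refine mem_image.2 ⟨u, mem_filter.2 ⟨huA, by omega⟩, ?_⟩
  exact (eq_of_subset_of_card_le hsub (by omega)).symm

/-- Sorts the vertices of `A` by their number of rim facets: 0 in the core, at most 2 everywhere,
and 2 exactly once per cut edge. -/
theorem weight_counts (h : BeltSide K A) (hK : IsSimpleSphere K) :
    weight K A = #{t ∈ A | #(t ∩ rim K A) = 1} + 2 * #(cut K A) ∧
    #A = #(core K A) + #{t ∈ A | #(t ∩ rim K A) = 1} + #(cut K A) := by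
  rw [← h.card_filter_inter_eq_two hK, IsSimpleSphere.weight_eq_sum, core]
  simp only [card_filter, mul_sum, ← sum_add_distrib]
  refine ⟨sum_congr rfl fun t ht => ?_, ?_⟩
  · have := h.card_inter_rim_le hK ht
    interval_cases #(t ∩ rim K A) <;> simp
  · rw [card_eq_sum_ones]
    refine sum_congr rfl fun t ht => ?_
    have := h.card_inter_rim_le hK ht
    interval_cases #(t ∩ rim K A) <;> simp

theorem card_add_card_cut (h : BeltSide K A) (hK : IsSimpleSphere K) :
    #A + #(cut K A) = #(core K A) + weight K A := by
  have := h.weight_counts hK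
  omega

theorem card_cut_core_add_le (h : BeltSide K A) (hK : IsSimpleSphere K) :
    #(cut K (core K A)) + 2 * #(cut K A) ≤ weight K A := by
  have := h.weight_counts hK
  have := h.card_cut_core_le hK
  omega

end BeltSide

end FacetTriples

/-! ### Descent: no 3-belts, and 4-belts only around quadrangles -/

namespace FacetTriples

variable {ι : Type*} [DecidableEq ι] {K A : Finset (Finset ι)}

theorem nodup_four_iff {α : Type*} {a b c d : α} : [a, b, c, d].Nodup ↔
    (a ≠ b ∧ a ≠ c ∧ a ≠ d) ∧ (b ≠ c ∧ b ≠ d) ∧ c ≠ d := by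
  simp

namespace BeltSide

theorem nonempty_ne (h : BeltSide K A) (hK : IsSimpleSphere K) (hc : 0 < #(cut K A)) :
    A.Nonempty ∧ A ≠ K := by
  obtain ⟨e, he⟩ := card_pos.1 hc
  obtain ⟨-, t, ht, u, hu, huA, -⟩ := (hK.mem_cut_iff h.subset).1 he
  exact ⟨⟨t, ht⟩, fun h => huA (h ▸ hu)⟩

theorem core_ne (h : BeltSide K A) (hK : IsSimpleSphere K) (hc : 0 < #(cut K A)) :
    core K A ≠ K := by
  intro he
  exact (h.nonempty_ne hK hc).2 (Subset.antisymm h.subset (by rw [← he]; exact core_subset K A))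

theorem card_core_add_le (h : BeltSide K A) (hK : IsSimpleSphere K) :
    #(core K A) + #(cut K A) ≤ #A := by
  have := h.weight_counts hK
  omega

theorem card_core_lt (h : BeltSide K A) (hK : IsSimpleSphere K) :
    #(core K A) + #(cut K A) ≤ #K :=
  (h.card_core_add_le hK).trans (card_le_card h.subset)

/-- Degrees of about 5 make a heavy side large: eliminate the number of inner facets and their
degree sum. The large core this forces is what makes peeling work. -/
theorem two_mul_weight_le [Fintype ι] [Nonempty ι] (h : BeltSide K A) (hK : IsSimpleSphere K)
    (hP : PentHex K) (hc : 0 < #(cut K A)) (h5 : #(cut K A) ≤ 5) :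
    2 * weight K A + 8 ≤ #A + 5 * #(cut K A) := by
  obtain ⟨h0, h1⟩ := h.nonempty_ne hK hc
  have := hK.two_mul_card_innerFacets h.subset h0 h1 h5
  have := hK.sum_degree_add_weight h.subset
  have := hP.five_mul_card_le (innerFacets K A)
  omega

end BeltSide

theorem card_eq_one_of_cut_eq_triangle (hK : IsSimpleSphere K) (hA : A ⊆ K) {a b c : ι}
    (hab : a ≠ b) (hbc : b ≠ c) (hca : c ≠ a) (hcut : cut K A = {{a, b}, {b, c}, {c, a}})
    (habc : {a, b, c} ∈ K) : #A = 1 ∨ #A + 1 = #K := by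
  have h1 : cut K A = cut K {{a, b, c}} := by
    rw [hcut, IsSimpleSphere.cut_singleton habc, pairs_eq_powersetCard hab hbc hca]
  have hsub : {{a, b, c}} ⊆ K := singleton_subset_iff.2 habc
  rcases hK.eq_or_eq_sdiff_of_cut_eq hA hsub h1 with h | h
  · exact Or.inl (by rw [h, card_singleton])
  · right
    have := card_le_card hsub
    rw [card_singleton] at this
    rw [h, card_sdiff_of_subset hsub, card_singleton]
    omega

theorem card_eq_two_of_cut_eq_square (hK : IsSimpleSphere K) (hA : A ⊆ K) {a b c d : ι}
    (hn : [a, b, c, d].Nodup) (hcut : cut K A = {{a, b}, {b, c}, {c, d}, {d, a}})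
    (h4 : #(cut K A) = 4) (habc : {a, b, c} ∈ K) (hacd : {a, c, d} ∈ K) :
    #A = 2 ∨ #A + 2 = #K := by
  rw [nodup_four_iff] at hn
  obtain ⟨⟨hab, hac, had⟩, ⟨hbc, hbd⟩, hcd⟩ := hn
  have hne : ({a, b, c} : Finset ι) ≠ {a, c, d} := by
    intro h
    have : b ∈ ({a, c, d} : Finset ι) := by rw [← h]; simp
    simp [hab.symm, hbc, hbd] at this
  set T : Finset (Finset ι) := {{a, b, c}, {a, c, d}} with hT
  have hsub : T ⊆ K := by
    intro x hx
    simp only [hT, mem_insert, mem_singleton] at hx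
    rcases hx with rfl | rfl <;> assumption
  have hT2 : #T = 2 := card_pair hne
  have hsub' : cut K A ⊆ cut K T := by
    intro e he
    refine mem_filter.2 ⟨cut_subset _ _ he, card_eq_one.2 ?_⟩
    rw [hcut] at he
    simp only [mem_insert, mem_singleton] at he
    rcases he with rfl | rfl | rfl | rfl
    · refine ⟨{a, b, c}, ?_⟩
      simp [hT, filter_insert, filter_singleton, insert_subset_iff, hab.symm, hbc, hbd]
    · refine ⟨{a, b, c}, ?_⟩
      simp [hT, filter_insert, filter_singleton, insert_subset_iff, hab.symm, hbc, hbd]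
    · refine ⟨{a, c, d}, ?_⟩
      simp [hT, filter_insert, filter_singleton, insert_subset_iff, had.symm, hcd.symm, hbd.symm]
    · refine ⟨{a, c, d}, ?_⟩
      simp [hT, filter_insert, filter_singleton, insert_subset_iff, had.symm, hcd.symm, hbd.symm]
  have hin : 0 < #(innerEdges K T) := by
    refine card_pos.2 ⟨{a, c}, mem_filter.2 ⟨mem_edges_of_subset habc ?_ (card_pair hac), ?_⟩⟩
    · intro x
      simp
      tauto
    · rw [filter_true_of_mem, hT2]
      intro x hx
      simp only [hT, mem_insert, mem_singleton] at hx
      rcases hx with rfl | rfl <;> simp [insert_subset_iff]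
  have hc := hK.two_mul_card_innerEdges hsub
  -- The two triples span six edge ends, two of which are used up by the inner edge `{a, c}`, so
  -- `cut K T` has at most four edges.
  have h1 : cut K A = cut K T := eq_of_subset_of_card_le hsub' (by omega)
  rcases hK.eq_or_eq_sdiff_of_cut_eq hA hsub h1 with h | h
  · exact Or.inl (by rw [h, hT2])
  · right
    have := card_le_card hsub
    rw [h, card_sdiff_of_subset hsub, hT2]
    omega

section Flag

variable [Fintype ι] [Nonempty ι]

/-- The degree bound gives #core ≥ weight - 4 ≥ 2, so the core has a cut of at least 3 edges, and at
most weight - 6. At weight 9 the cut is a triangle; it does not surround a single vertex, since the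
core has at least 5 vertices and misses at least 3. -/
theorem BeltSide.core_of_card_eq_three (h : BeltSide K A) (hK : IsSimpleSphere K) (hP : PentHex K)
    (h3 : #(cut K A) = 3) :
    9 ≤ weight K A ∧ (weight K A ≤ 9 → BeltSide K (core K A) ∧ #(cut K (core K A)) = 3) := by
  have a1 := h.two_mul_weight_le hK hP (by omega) (by omega)
  have a2 := h.card_add_card_cut hK
  have a3 := h.card_cut_core_add_le hK
  have a4 := h.card_core_lt hK
  have hcK : core K A ⊆ K := (core_subset K A).trans h.subset
  have a5 := hK.three_le_card_cut hcK (card_pos.1 (by omega)) (h.core_ne hK (by omega))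
  refine ⟨by omega, fun h9 => ?_⟩
  have h3' : #(cut K (core K A)) = 3 := by omega
  refine ⟨?_, h3'⟩
  obtain ⟨a, b, c, hab, hbc, hca, hcut⟩ := exists_triangle_of_even
    (fun _ he => card_of_mem_edges (cut_subset _ _ he)) (hK.even_card_cut_filter hcK) h3'
  refine beltSide_of_triangle hK hcK hab hbc hca hcut fun habc => ?_
  have := card_eq_one_of_cut_eq_triangle hK hcK hab hbc hca hcut habc
  omega

/-- Descent: a side of weight 9 has as core a smaller side of a 3-belt, and without a heptagon
inside the core weighs no more. -/
theorem BeltSide.ten_le_weight (hK : IsSimpleSphere K) (hP : PentHex K) (h : BeltSide K A)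
    (h3 : #(cut K A) = 3) (hdeg : ∀ i ∈ innerFacets K A, degree K i ≤ 6) : 10 ≤ weight K A := by
  induction hn : #A using Nat.strong_induction_on generalizing A with
  | _ n ih =>
    by_contra! hlt
    obtain ⟨hB, hB3⟩ := (h.core_of_card_eq_three hK hP h3).2 (by omega)
    have h1 := h.card_core_add_le hK
    have h2 := ih _ (by omega) hB hB3
      (fun i hi => hdeg i (innerFacets_mono (core_subset K A) hi)) rfl
    have h4 := hK.weight_mono h.subset (core_subset K A) (hB.nonempty_ne hK (by omega)).1
      (h.nonempty_ne hK (by omega)).2 (by omega) (by omega) hdeg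
    omega

/-- There are no 3-belts: the two weights would total at least 10 + 10 against 19, or 10 + 9 against
18 when a heptagon lies inside a side and so off the rim. -/
theorem mem_of_edges (hK : IsSimpleSphere K) (hP : PentHex K) {a b c : ι} (hab : a ≠ b)
    (hbc : b ≠ c) (hca : c ≠ a) (h1 : {a, b} ∈ edges K) (h2 : {b, c} ∈ edges K)
    (h3 : {c, a} ∈ edges K) : {a, b, c} ∈ K := by
  by_contra habc
  have hsubE : ({{a, b}, {b, c}, {c, a}} : Finset (Finset ι)) ⊆ edges K := by
    intro x hx
    simp only [mem_insert, mem_singleton] at hx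
    rcases hx with rfl | rfl | rfl <;> assumption
  have hc3 : #({a, b, c} : Finset ι) = 3 := card_eq_three.2 ⟨a, b, c, hab, hca.symm, hbc, rfl⟩
  obtain ⟨A, hA, hcut⟩ := hK.exists_cut_eq hsubE (by
    intro i
    by_cases hi : i ∈ ({a, b, c} : Finset ι)
    · have : {e ∈ powersetCard 2 ({a, b, c} : Finset ι) | i ∈ e} =
          (({a, b, c} : Finset ι).erase i).image (fun j => {i, j}) := by
        ext e
        simp only [mem_filter, mem_powersetCard, mem_image]
        constructor
        · rintro ⟨⟨hsub, h2⟩, hie⟩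
          obtain ⟨j, hj⟩ := card_eq_one.1
            (show #(e.erase i) = 1 by rw [card_erase_of_mem hie, h2])
          have hje : j ∈ e.erase i := by simp [hj]
          refine ⟨j, erase_subset_erase _ hsub hje, ?_⟩
          rw [← insert_erase hie, hj]
        · rintro ⟨j, hj, rfl⟩
          refine ⟨⟨?_, card_pair (mem_erase.1 hj).1.symm⟩, by simp⟩
          intro x hx
          simp only [mem_insert, mem_singleton] at hx
          rcases hx with rfl | rfl
          exacts [hi, mem_of_mem_erase hj]
      rw [pairs_eq_powersetCard hab hbc hca, this, card_image_of_injOn, card_erase_of_mem hi, hc3]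
      · exact ⟨1, rfl⟩
      · intro x hx y hy hxy
        have : x ∈ ({i, y} : Finset ι) := by
          rw [← show ({i, x} : Finset ι) = {i, y} from hxy]
          simp
        have hxi : x ≠ i := (mem_erase.1 (mem_coe.1 hx)).1
        simpa [hxi] using this
    · have : {e ∈ powersetCard 2 ({a, b, c} : Finset ι) | i ∈ e} = ∅ := by
        rw [filter_eq_empty_iff]
        intro e he hie
        exact hi ((mem_powersetCard.1 he).1 hie)
      rw [pairs_eq_powersetCard hab hbc hca, this]
      simp)
  have h3' : #(cut K A) = 3 := by
    rw [hcut, pairs_eq_powersetCard hab hbc hca, card_powersetCard, hc3]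
    rfl
  have hB := beltSide_of_triangle hK hA hab hbc hca hcut habc
  have hB' := hB.sdiff hK
  have h3'' : #(cut K (K \ A)) = 3 := by rw [hK.cut_sdiff hA, h3']
  have hw := hK.weight_add_weight_sdiff hA
  have hr := hK.card_rim_le hA
  have s1 := (hB.core_of_card_eq_three hK hP h3').1
  have s2 := (hB'.core_of_card_eq_three hK hP h3'').1
  have key : ∀ x, degree K x = 7 → x ∉ rim K A → ∑ i ∈ rim K A, degree K i ≤ 18 := by
    intro x hx hxr
    have := sum_degree_le_of_forall (K := K) (D := rim K A) (fun i hi => by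
      have h7 := hP.le_seven i
      have hne : degree K i ≠ 7 := fun h => hxr (hP.unique x i (Or.inr hx) (Or.inr h) ▸ hi)
      omega)
    omega
  have key2 : ∀ x, degree K x = 7 → ∀ i, i ≠ x → degree K i ≤ 6 := by
    intro x hx i hix
    have h7 := hP.le_seven i
    have hne : degree K i ≠ 7 := fun h => hix (hP.unique i x (Or.inr h) (Or.inr hx))
    omega
  by_cases hx : ∃ x ∈ innerFacets K A, degree K x = 7
  · obtain ⟨x, hxD, hx⟩ := hx
    have := key x hx (hK.notMem_rim_of_mem_innerFacets hA hxD)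
    have := BeltSide.ten_le_weight hK hP hB' h3'' (fun i hi => key2 x hx i fun h =>
      hK.notMem_innerFacets_sdiff hxD (h ▸ hi))
    omega
  have t1 := BeltSide.ten_le_weight hK hP hB h3' (fun i hi => by
    have h7 := hP.le_seven i
    have hne : degree K i ≠ 7 := fun h => hx ⟨i, hi, h⟩
    omega)
  by_cases hx' : ∃ x ∈ innerFacets K (K \ A), degree K x = 7
  · obtain ⟨x, hxD, hx⟩ := hx'
    have hxr := hK.notMem_rim_of_mem_innerFacets sdiff_subset hxD
    rw [hK.rim_sdiff hA] at hxr
    have := key x hx hxr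
    omega
  have t2 := BeltSide.ten_le_weight hK hP hB' h3'' (fun i hi => by
    have h7 := hP.le_seven i
    have hne : degree K i ≠ 7 := fun h => hx' ⟨i, hi, h⟩
    omega)
  have := hP.sum_degree_le (rim K A)
  omega

/-- An empty core forces weight 8, four vertices and one inner facet, of degree 4. A nonempty core
has at least 3 vertices, and its cut has 3 or 4 edges. Three edges would enclose a single vertex, as
there are no 3-belts. So there are four and the weight is 12; then the core has at least 4 vertices
and misses at least 4, while a chord would leave 2 on one side. -/
theorem BeltSide.core_of_card_eq_four (h : BeltSide K A) (hK : IsSimpleSphere K) (hP : PentHex K)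
    (h4 : #(cut K A) = 4) (h12 : weight K A ≤ 12) :
    (∃ q, degree K q = 4 ∧ A = {t ∈ K | q ∈ t}) ∨
      (weight K A = 12 ∧ BeltSide K (core K A) ∧ #(cut K (core K A)) = 4) := by
  have a1 := h.two_mul_weight_le hK hP (by omega) (by omega)
  have a2 := h.card_add_card_cut hK
  have a3 := h.card_cut_core_add_le hK
  have a4 := h.card_core_lt hK
  have hcK : core K A ⊆ K := (core_subset K A).trans h.subset
  obtain ⟨h0, h1⟩ := h.nonempty_ne hK (by omega)
  rcases (core K A).eq_empty_or_nonempty with hemp | hne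
  · left
    rw [hemp, card_empty] at a2
    have a5 := hK.two_mul_card_innerFacets h.subset h0 h1 (by omega)
    have a6 := hK.sum_degree_add_weight h.subset
    obtain ⟨q, hq⟩ := card_eq_one.1 (show #(innerFacets K A) = 1 by omega)
    rw [hq, sum_singleton] at a6
    refine ⟨q, by omega, ?_⟩
    symm
    refine eq_of_subset_of_card_le ?_ ?_
    · intro t ht
      obtain ⟨ht, hqt⟩ := mem_filter.1 ht
      have hqD : q ∈ innerFacets K A := by simp [hq]
      exact (mem_filter.1 hqD).2 t ht hqt
    · change #A ≤ degree K q
      omega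
  · right
    have a5 := hK.three_le_card_cut hcK hne (h.core_ne hK (by omega))
    have h4' : #(cut K (core K A)) = 4 := by
      by_contra hn4
      obtain ⟨a, b, c, hab, hbc, hca, hcut⟩ := exists_triangle_of_even
        (fun _ he => card_of_mem_edges (cut_subset _ _ he)) (hK.even_card_cut_filter hcK)
        (show #(cut K (core K A)) = 3 by omega)
      have hE : ∀ e ∈ ({{a, b}, {b, c}, {c, a}} : Finset (Finset ι)), e ∈ edges K := by
        intro e he
        rw [← hcut] at he
        exact cut_subset _ _ he
      have habc := mem_of_edges hK hP hab hbc hca (hE _ (by simp)) (hE _ (by simp))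
        (hE _ (by simp))
      have := card_eq_one_of_cut_eq_triangle hK hcK hab hbc hca hcut habc
      omega
    refine ⟨by omega, ?_, h4'⟩
    obtain ⟨a, b, c, d, hn, hcut⟩ := exists_square_of_even
      (fun _ he => card_of_mem_edges (cut_subset _ _ he)) (hK.even_card_cut_filter hcK) h4'
    have hn' := hn
    rw [nodup_four_iff] at hn'
    obtain ⟨⟨hab, hac, had⟩, ⟨hbc, hbd⟩, hcd⟩ := hn'
    have key : ∀ a b c d : ι, [a, b, c, d].Nodup →
        cut K (core K A) = {{a, b}, {b, c}, {c, d}, {d, a}} → {a, c} ∉ edges K := by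
      intro a b c d hn hcut hacE
      have hE : ∀ e ∈ ({{a, b}, {b, c}, {c, d}, {d, a}} : Finset (Finset ι)), e ∈ edges K := by
        intro e he
        rw [← hcut] at he
        exact cut_subset _ _ he
      have hn' := hn
      rw [nodup_four_iff] at hn'
      obtain ⟨⟨hab, hac, had⟩, ⟨hbc, hbd⟩, hcd⟩ := hn'
      have h1 := mem_of_edges hK hP hab hbc hac.symm (hE _ (by simp)) (hE _ (by simp))
        (by rwa [pair_comm])
      have h2 := mem_of_edges hK hP hac hcd had.symm hacE (hE _ (by simp)) (hE _ (by simp))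
      have := card_eq_two_of_cut_eq_square hK hcK hn hcut h4' h1 h2
      omega
    refine beltSide_of_square hK hcK hcut hac hbd (key a b c d hn hcut) (key b c d a ?_ ?_)
    · exact nodup_four_iff.2 ⟨⟨hbc, hbd, hab.symm⟩, ⟨hcd, hac.symm⟩, had.symm⟩
    · rw [hcut]
      ext e
      simp
      tauto

theorem BeltSide.thirteen_le_weight (hK : IsSimpleSphere K) (hP : PentHex K) (h : BeltSide K A)
    (h4 : #(cut K A) = 4)
    (hdeg : ∀ i ∈ innerFacets K A, degree K i ≠ 4 ∧ degree K i ≠ 7) : 13 ≤ weight K A := by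
  induction hn : #A using Nat.strong_induction_on generalizing A with
  | _ n ih =>
    by_contra! hlt
    rcases h.core_of_card_eq_four hK hP h4 (by omega) with ⟨q, hq, hA⟩ | ⟨-, hB, hB4⟩
    · refine (hdeg q ?_).1 hq
      simp only [innerFacets, mem_filter, mem_univ, true_and]
      intro t ht hqt
      rw [hA]
      exact mem_filter.2 ⟨ht, hqt⟩
    have h1 := h.card_core_add_le hK
    have h2 := ih _ (by omega) hB hB4
      (fun i hi => hdeg i (innerFacets_mono (core_subset K A) hi)) rfl
    have h4 := hK.weight_mono h.subset (core_subset K A) (hB.nonempty_ne hK (by omega)).1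
      (h.nonempty_ne hK (by omega)).2 (by omega) (by omega) (fun i hi => by
        have := (hdeg i hi).2
        have := hP.le_seven i
        omega)
    omega

/-- If the exceptional facet lies on one side of a `4`-belt, this side is the star of a
quadrangle. -/
theorem BeltSide.exists_quadrangle (h : BeltSide K A) (hK : IsSimpleSphere K) (hP : PentHex K)
    (h4 : #(cut K A) = 4) {x : ι} (hxA : x ∈ innerFacets K A)
    (hx : degree K x = 4 ∨ degree K x = 7) : ∃ q, degree K q = 4 ∧ A = {t ∈ K | q ∈ t} := by
  have h4' : #(cut K (K \ A)) = 4 := by rw [hK.cut_sdiff h.subset, h4]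
  have hne : ∀ i, i ≠ x → degree K i ≠ 4 ∧ degree K i ≠ 7 := fun i hi =>
    ⟨fun h => hi (hP.unique i x (Or.inl h) hx), fun h => hi (hP.unique i x (Or.inr h) hx)⟩
  -- The opposite side weighs at least 13 and the rim, free of the exceptional facet, has degree sum
  -- at most 24. The weight of `A` is thus at most 11, below the 12 of the descending alternative.
  have h13 := BeltSide.thirteen_le_weight hK hP (h.sdiff hK) h4' (fun i hi => hne i fun h =>
    hK.notMem_innerFacets_sdiff hxA (h ▸ hi))
  have hw := hK.weight_add_weight_sdiff h.subset
  have hr := hK.card_rim_le h.subset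
  have := sum_degree_le_of_forall (K := K) (D := rim K A) (fun i hi => by
    have h7 := hP.le_seven i
    have := hne i fun he => hK.notMem_rim_of_mem_innerFacets h.subset hxA (he ▸ hi)
    omega)
  rcases h.core_of_card_eq_four hK hP h4 (by omega) with hq | ⟨h12, -⟩
  · exact hq
  · omega

theorem exists_quadrangle_of_square (hK : IsSimpleSphere K) (hP : PentHex K) {a b c d : ι}
    (hn : [a, b, c, d].Nodup) (hab : {a, b} ∈ edges K) (hbc : {b, c} ∈ edges K)
    (hcd : {c, d} ∈ edges K) (hda : {d, a} ∈ edges K) (hac : {a, c} ∉ edges K)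
    (hbd : {b, d} ∉ edges K) :
    ∃ q, degree K q = 4 ∧ ∀ x, x = a ∨ x = b ∨ x = c ∨ x = d → x ≠ q ∧ {q, x} ∈ edges K := by
  rw [nodup_four_iff] at hn
  obtain ⟨⟨nab, nac, nad⟩, ⟨nbc, nbd⟩, ncd⟩ := hn
  have hsubE : ({{a, b}, {b, c}, {c, d}, {d, a}} : Finset (Finset ι)) ⊆ edges K := by
    intro x hx
    simp only [mem_insert, mem_singleton] at hx
    rcases hx with rfl | rfl | rfl | rfl <;> assumption
  have hpne : ∀ {x y z w : ι}, x ≠ z → x ≠ w → ({x, y} : Finset ι) ≠ {z, w} := by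
    intro x y z w h1 h2 h
    have : x ∈ ({z, w} : Finset ι) := by rw [← h]; simp
    simp [h1, h2] at this
  have d1 : ({a, b} : Finset ι) ≠ {b, c} := hpne nab nac
  have d2 : ({a, b} : Finset ι) ≠ {c, d} := hpne nac nad
  have d3 : ({a, b} : Finset ι) ≠ {d, a} := by rw [pair_comm a b]; exact hpne nbd nab.symm
  have d4 : ({b, c} : Finset ι) ≠ {c, d} := hpne nbc nbd
  have d5 : ({b, c} : Finset ι) ≠ {d, a} := hpne nbd nab.symm
  have d6 : ({c, d} : Finset ι) ≠ {d, a} := hpne ncd nac.symm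
  obtain ⟨A, hA, hcut⟩ := hK.exists_cut_eq hsubE (by
    intro i
    simp only [filter_insert, filter_singleton, mem_insert, mem_singleton]
    by_cases ha : i = a
    · subst ha
      simp [nab, nac, nad, card_pair d3]
    by_cases hb : i = b
    · subst hb
      simp [nab.symm, nbc, nbd, card_pair d1]
    by_cases hc : i = c
    · subst hc
      simp [nac.symm, nbc.symm, ncd, card_pair d4]
    by_cases hd : i = d
    · subst hd
      simp [nad.symm, nbd.symm, ncd.symm, card_pair d6]
    simp [ha, hb, hc, hd])
  have h4 : #(cut K A) = 4 := by
    rw [hcut, card_insert_of_notMem, card_insert_of_notMem, card_pair d6]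
    · simp [d4, d5]
    · simp [d1, d2, d3]
  have hB := beltSide_of_square hK hA hcut nac nbd hac hbd
  have h4' : #(cut K (K \ A)) = 4 := by rw [hK.cut_sdiff hA, h4]
  have main : ∀ A' : Finset (Finset ι), A' ⊆ K → cut K A' = {{a, b}, {b, c}, {c, d}, {d, a}} →
      (∃ q, degree K q = 4 ∧ A' = {t ∈ K | q ∈ t}) →
      ∃ q, degree K q = 4 ∧ ∀ x, x = a ∨ x = b ∨ x = c ∨ x = d → x ≠ q ∧ {q, x} ∈ edges K := by
    rintro A' hA' hcut ⟨q, hq, hAq⟩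
    refine ⟨q, hq, fun x hx => ?_⟩
    have hxr : x ∈ rim K A' := by
      rw [rim_eq_of_square hcut]
      simpa using hx
    obtain ⟨e, he, hxe⟩ := mem_rim.1 hxr
    obtain ⟨h2, t, ht, u, hu, huA, het, heu⟩ := (hK.mem_cut_iff hA').1 he
    rw [hAq, mem_filter] at ht huA
    have hxq : x ≠ q := by
      rintro rfl
      exact huA ⟨hu, heu hxe⟩
    refine ⟨hxq, mem_edges_of_subset ht.1 ?_ (card_pair hxq.symm)⟩
    intro y hy
    simp only [mem_insert, mem_singleton] at hy
    rcases hy with rfl | rfl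
    exacts [ht.2, het hxe]
  by_cases hx : ∃ x ∈ innerFacets K A, degree K x = 4 ∨ degree K x = 7
  · obtain ⟨x, hxA, hx⟩ := hx
    exact main A hA hcut (hB.exists_quadrangle hK hP h4 hxA hx)
  by_cases hx' : ∃ x ∈ innerFacets K (K \ A), degree K x = 4 ∨ degree K x = 7
  · obtain ⟨x, hxA, hx⟩ := hx'
    exact main (K \ A) sdiff_subset (by rw [hK.cut_sdiff hA, hcut])
      ((hB.sdiff hK).exists_quadrangle hK hP h4' hxA hx)
  -- With no exceptional facet inside either side, the weights total at least 26, while four rim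
  -- facets have degree sum at most 25.
  push Not at hx hx'
  have t1 := BeltSide.thirteen_le_weight hK hP hB h4 hx
  have t2 := BeltSide.thirteen_le_weight hK hP (hB.sdiff hK) h4' hx'
  have hw := hK.weight_add_weight_sdiff hA
  have hr := hK.card_rim_le hA
  have := hP.sum_degree_le (rim K A)
  omega

/-- The facets around a quadrangle form a chordless cycle. -/
theorem exists_square_of_quadrangle (hK : IsSimpleSphere K) (hP : PentHex K) {q : ι}
    (hq : degree K q = 4) : ∃ a b c d, [a, b, c, d].Nodup ∧
      ({q, a, b} ∈ K ∧ {q, b, c} ∈ K ∧ {q, c, d} ∈ K ∧ {q, d, a} ∈ K) ∧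
      {a, c} ∉ edges K ∧ {b, d} ∉ edges K ∧
      ∀ x, x ≠ q → ({q, x} ∈ edges K ↔ x = a ∨ x = b ∨ x = c ∨ x = d) := by
  -- The link of `q`. It meets every `i ≠ q` in 0 or 2 pairs, one for each end of the edge `{q, i}`
  -- if there is one, so its four pairs form a square.
  set C : Finset (Finset ι) := {t ∈ K | q ∈ t}.image (fun t => t.erase q) with hCdef
  have hinj : Set.InjOn (fun t : Finset ι => t.erase q) ({t ∈ K | q ∈ t} : Finset (Finset ι)) := by
    intro s hs t ht hst
    rw [← insert_erase (mem_filter.1 (mem_coe.1 hs)).2, show s.erase q = t.erase q from hst,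
      insert_erase (mem_filter.1 (mem_coe.1 ht)).2]
  have hC2 : ∀ e ∈ C, #e = 2 := by
    intro e he
    obtain ⟨t, ht, rfl⟩ := mem_image.1 he
    rw [mem_filter] at ht
    rw [card_erase_of_mem ht.2, hK.card_eq t ht.1]
  have hC4 : #C = 4 := by
    rw [hCdef, card_image_of_injOn hinj]
    exact hq
  have hCmem : ∀ x y : ι, {x, y} ∈ C → {q, x, y} ∈ K ∧ x ≠ q ∧ y ≠ q := by
    intro x y hxy
    obtain ⟨t, ht, hte⟩ := mem_image.1 hxy
    rw [mem_filter] at ht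
    have hx : x ∈ t.erase q := by rw [hte]; simp
    have hy : y ∈ t.erase q := by rw [hte]; simp
    refine ⟨?_, (mem_erase.1 hx).1, (mem_erase.1 hy).1⟩
    have : ({q, x, y} : Finset ι) = t := by
      rw [← insert_erase ht.2, hte]
    rw [this]
    exact ht.1
  have hev : ∀ i, Even #{e ∈ C | i ∈ e} := by
    intro i
    by_cases hiq : i = q
    · subst hiq
      rw [filter_false_of_mem]
      · simp
      · intro e he
        obtain ⟨t, -, rfl⟩ := mem_image.1 he
        simp
    · have h1 : #{e ∈ C | i ∈ e} = #{t ∈ K | {q, i} ⊆ t} := by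
        rw [hCdef, filter_image, card_image_of_injOn (hinj.mono (coe_subset.2 (filter_subset _ _))),
          filter_filter]
        congr 1
        ext t
        simp [insert_subset_iff, hiq]
      rw [h1]
      by_cases he : {q, i} ∈ edges K
      · rw [hK.card_filter_subset he]
        exact even_two
      · rw [filter_false_of_mem]
        · simp
        · intro t ht hsub
          exact he (mem_edges_of_subset ht hsub (card_pair (Ne.symm hiq)))
  obtain ⟨a, b, c, d, hn, hC⟩ := exists_square_of_even hC2 hev hC4
  have hn' := hn
  rw [nodup_four_iff] at hn'
  obtain ⟨⟨nab, nac, nad⟩, ⟨nbc, nbd⟩, ncd⟩ := hn'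
  have hqab := hCmem a b (by simp [hC])
  have hqbc := hCmem b c (by simp [hC])
  have hqcd := hCmem c d (by simp [hC])
  have hqda := hCmem d a (by simp [hC])
  have hqe : ∀ {x y : ι}, {q, x, y} ∈ K → x ≠ q → {q, x} ∈ edges K := by
    intro x y h hx
    refine mem_edges_of_subset h ?_ (card_pair hx.symm)
    intro z
    simp
    tauto
  -- Two adjacent neighbours of `q` share a vertex with `q`, as there are no 3-belts, so they form a
  -- pair of the link; the diagonals of the square do not.
  have hnot : ∀ {x y : ι}, x ≠ y → x ≠ q → y ≠ q → {q, x} ∈ edges K → {q, y} ∈ edges K →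
      {x, y} ∉ C → {x, y} ∉ edges K := by
    intro x y hxy hxq hyq hqx hqy hC hE
    have := mem_of_edges hK hP hxq.symm hxy hyq hqx hE (by rwa [pair_comm])
    refine hC (mem_image.2 ⟨_, mem_filter.2 ⟨this, by simp⟩, ?_⟩)
    rw [erase_insert]
    simp [hxq.symm, hyq.symm]
  have hpne : ∀ {x y z w : ι}, x ≠ z → x ≠ w → ({x, y} : Finset ι) ≠ {z, w} := by
    intro x y z w h1 h2 h
    have : x ∈ ({z, w} : Finset ι) := by rw [← h]; simp
    simp [h1, h2] at this
  refine ⟨a, b, c, d, hn, ⟨hqab.1, hqbc.1, hqcd.1, hqda.1⟩, ?_, ?_, ?_⟩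
  · refine hnot nac hqab.2.1 hqcd.2.1 (hqe hqab.1 hqab.2.1) (hqe hqcd.1 hqcd.2.1) ?_
    rw [hC]
    simp only [mem_insert, mem_singleton, not_or]
    refine ⟨?_, hpne nab nac, ?_, ?_⟩
    · rw [pair_comm a c]
      exact hpne nac.symm nbc.symm
    · exact hpne nac nad
    · rw [pair_comm a c]
      exact hpne ncd nac.symm
  · refine hnot nbd hqbc.2.1 hqda.2.1 (hqe hqbc.1 hqbc.2.1) (hqe hqda.1 hqda.2.1) ?_
    rw [hC]
    simp only [mem_insert, mem_singleton, not_or]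
    refine ⟨?_, ?_, ?_, ?_⟩
    · rw [pair_comm b d]
      exact hpne nad.symm nbd.symm
    · rw [pair_comm b d]
      exact hpne nbd.symm ncd.symm
    · exact hpne nbc nbd
    · exact hpne nbd nab.symm
  · intro x hxq
    constructor
    · intro h
      obtain ⟨t, ht, hsub, -⟩ := mem_edges.1 h
      have hC' : t.erase q ∈ C :=
        mem_image.2 ⟨t, mem_filter.2 ⟨ht, hsub (by simp)⟩, rfl⟩
      have hx : x ∈ t.erase q := mem_erase.2 ⟨hxq, hsub (by simp)⟩
      rw [hC] at hC'
      simp only [mem_insert, mem_singleton] at hC'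
      rcases hC' with h | h | h | h <;> rw [h] at hx <;> simp at hx <;> tauto
    · rintro (rfl | rfl | rfl | rfl)
      exacts [hqe hqab.1 hqab.2.1, hqe hqbc.1 hqbc.2.1, hqe hqcd.1 hqcd.2.1, hqe hqda.1 hqda.2.1]

end Flag

end FacetTriples

/-! ### Vertices and edge directions of polytopes -/

namespace ConvexPolytope

section General

variable {n : ℕ} (P : ConvexPolytope n)

/-- The inequalities that are equalities at `x`. -/
noncomputable def tight (x : EuclideanSpace ℝ (Fin n)) : Finset (Fin P.m) :=
  {i | inner ℝ (P.a i) x + P.b i = 0}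

/-- The intersection of the facets with indices in `S`. -/
def face (S : Finset (Fin P.m)) : Set (EuclideanSpace ℝ (Fin n)) :=
  {x | x ∈ P.carrier ∧ S ⊆ P.tight x}

variable {P}

theorem mem_tight {x : EuclideanSpace ℝ (Fin n)} {i : Fin P.m} :
    i ∈ P.tight x ↔ inner ℝ (P.a i) x + P.b i = 0 := by simp [tight]

theorem mem_facet {x : EuclideanSpace ℝ (Fin n)} {i : Fin P.m} :
    x ∈ P.facet i ↔ x ∈ P.carrier ∧ i ∈ P.tight x := by
  rw [mem_tight]
  rfl

theorem carrier_inter_iInter_facet (S : Finset (Fin P.m)) :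
    P.carrier ∩ ⋂ i ∈ S, P.facet i = P.face S := by
  ext x
  simp only [Set.mem_inter_iff, Set.mem_iInter, mem_facet, face, Set.mem_ofPred_eq]
  exact ⟨fun h => ⟨h.1, fun i hi => (h.2 i hi).2⟩, fun h => ⟨h.1, fun i hi => ⟨h.1, h.2 hi⟩⟩⟩

theorem isFace_iff {G : Set (EuclideanSpace ℝ (Fin n))} : P.IsFace G ↔ ∃ S, G = P.face S := by
  simp only [IsFace, carrier_inter_iInter_facet]

theorem facet_inter_facet (i j : Fin P.m) : P.facet i ∩ P.facet j = P.face {i, j} := by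
  ext x
  simp only [Set.mem_inter_iff, mem_facet, face, Set.mem_ofPred_eq, insert_subset_iff,
    singleton_subset_iff]
  tauto

/-- Slack inequalities survive a small move by continuity, so only the tight ones constrain the
direction. -/
theorem exists_add_smul_mem {x u : EuclideanSpace ℝ (Fin n)} (hx : x ∈ P.carrier)
    (hu : ∀ i ∈ P.tight x, 0 ≤ inner ℝ (P.a i) u) : ∃ ε : ℝ, 0 < ε ∧ x + ε • u ∈ P.carrier := by
  have h : ∀ᶠ ε in nhdsWithin (0 : ℝ) (Set.Ioi 0), ∀ i, 0 ≤ inner ℝ (P.a i) (x + ε • u) + P.b i := by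
    rw [Filter.eventually_all]
    intro i
    simp only [inner_add_right, inner_smul_right]
    by_cases hi : i ∈ P.tight x
    · filter_upwards [self_mem_nhdsWithin] with ε hε
      have h1 := mem_tight.1 hi
      have h2 := mul_nonneg (le_of_lt (Set.mem_Ioi.1 hε)) (hu i hi)
      linarith
    · have hpos : 0 < inner ℝ (P.a i) x + P.b i :=
        lt_of_le_of_ne (hx i) (fun h => hi (mem_tight.2 h.symm))
      have hc : Continuous fun ε : ℝ => inner ℝ (P.a i) x + ε * inner ℝ (P.a i) u + P.b i := by
        fun_prop
      have := (hc.tendsto 0).eventually_const_lt (by simpa using hpos)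
      exact (this.filter_mono nhdsWithin_le_nhds).mono fun ε hε => hε.le
  obtain ⟨ε, hε, hpos⟩ := (h.and self_mem_nhdsWithin).exists
  exact ⟨ε, hpos, hε⟩

/-- The last point of the ray in the bounded set: some tight inequality must decrease there, or the
ray could be followed further. -/
theorem exists_exit {x u : EuclideanSpace ℝ (Fin n)} (hx : x ∈ P.carrier) (hu : u ≠ 0) :
    ∃ t : ℝ, 0 ≤ t ∧ x + t • u ∈ P.carrier ∧
      ∃ i ∈ P.tight (x + t • u), inner ℝ (P.a i) u < 0 := by
  set T : Set ℝ := {t | 0 ≤ t ∧ x + t • u ∈ P.carrier} with hT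
  have hcl : IsClosed T := by
    have : T = Set.Ici 0 ∩ ⋂ i, {t : ℝ | 0 ≤ inner ℝ (P.a i) (x + t • u) + P.b i} := by
      ext t
      simp [hT, carrier]
    rw [this]
    refine isClosed_Ici.inter (isClosed_iInter fun i => isClosed_le continuous_const ?_)
    fun_prop
  have hbd : Bornology.IsBounded T := by
    obtain ⟨R, hR⟩ := P.bounded.exists_norm_le
    refine (Metric.isBounded_Icc 0 ((R + ‖x‖) / ‖u‖)).subset ?_
    rintro t ⟨h0, ht⟩
    refine ⟨h0, ?_⟩
    rw [le_div_iff₀ (norm_pos_iff.2 hu)]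
    have h1 := hR _ ht
    have h2 : ‖t • u‖ ≤ ‖x + t • u‖ + ‖x‖ := by
      have := norm_sub_le (x + t • u) x
      rwa [add_sub_cancel_left] at this
    rw [norm_smul, Real.norm_of_nonneg h0] at h2
    linarith
  have hne : T.Nonempty := ⟨0, le_rfl, by simpa using hx⟩
  obtain ⟨t, ⟨ht0, ht⟩, hmax⟩ :=
    (Metric.isCompact_of_isClosed_isBounded hcl hbd).exists_isGreatest hne
  refine ⟨t, ht0, ht, ?_⟩
  by_contra! hcon
  obtain ⟨ε, hε, hmem⟩ := exists_add_smul_mem ht hcon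
  have : t + ε ∈ T := ⟨by linarith, by rwa [add_smul, ← add_assoc]⟩
  have := hmax this
  linarith

theorem isVertex_iff {v : EuclideanSpace ℝ (Fin n)} : P.IsVertex v ↔
    v ∈ P.carrier ∧ ∀ u, (∀ i ∈ P.tight v, inner ℝ (P.a i) u = 0) → u = 0 := by
  rw [IsVertex, isFace_iff]
  constructor
  · rintro ⟨S, hS⟩
    have hv : v ∈ P.face S := by rw [← hS]; rfl
    refine ⟨hv.1, fun u hu => ?_⟩
    obtain ⟨ε, hε, hmem⟩ := exists_add_smul_mem hv.1 fun i hi => (hu i hi).ge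
    have : v + ε • u ∈ P.face S := by
      refine ⟨hmem, fun i hi => mem_tight.2 ?_⟩
      rw [inner_add_right, inner_smul_right, hu i (hv.2 hi), mul_zero, add_zero]
      exact mem_tight.1 (hv.2 hi)
    rw [← hS, Set.mem_singleton_iff, add_eq_left, smul_eq_zero] at this
    exact this.resolve_left hε.ne'
  · rintro ⟨hv, h⟩
    refine ⟨P.tight v, Set.Subset.antisymm ?_ ?_⟩
    · rintro _ rfl
      exact ⟨hv, Subset.rfl⟩
    · rintro x ⟨hx, hsub⟩
      rw [Set.mem_singleton_iff, ← sub_eq_zero]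
      refine h _ fun i hi => ?_
      have h1 := mem_tight.1 hi
      have h2 := mem_tight.1 (hsub hi)
      rw [inner_sub_right]
      linarith

theorem IsVertex.mem_carrier {v : EuclideanSpace ℝ (Fin n)} (hv : P.IsVertex v) : v ∈ P.carrier :=
  (isVertex_iff.1 hv).1

theorem IsVertex.eq_of_tight_subset {v x : EuclideanSpace ℝ (Fin n)} (hv : P.IsVertex v)
    (h : P.tight v ⊆ P.tight x) : x = v := by
  rw [← sub_eq_zero]
  refine (isVertex_iff.1 hv).2 _ fun i hi => ?_
  have h1 := mem_tight.1 hi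
  have h2 := mem_tight.1 (h hi)
  rw [inner_sub_right]
  linarith

/-- At a point that is not a vertex there is a line along which all tight inequalities stay tight;
following it to its exit adds a new one. -/
theorem exists_isVertex {x : EuclideanSpace ℝ (Fin n)} (hx : x ∈ P.carrier) :
    ∃ v, P.IsVertex v ∧ P.tight x ⊆ P.tight v := by
  induction hk : P.m - #(P.tight x) using Nat.strong_induction_on generalizing x with
  | _ k ih =>
    by_cases hv : P.IsVertex x
    · exact ⟨x, hv, Subset.rfl⟩
    rw [isVertex_iff] at hv
    push Not at hv
    obtain ⟨u, hu, hu0⟩ := hv hx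
    obtain ⟨t, -, ht, i, hi, hneg⟩ := exists_exit hx hu0
    have hsub : P.tight x ⊆ P.tight (x + t • u) := by
      intro j hj
      rw [mem_tight, inner_add_right, inner_smul_right, hu j hj, mul_zero, add_zero]
      exact mem_tight.1 hj
    have hlt : #(P.tight x) < #(P.tight (x + t • u)) := by
      refine card_lt_card ⟨hsub, fun h => ?_⟩
      rw [hu i (h hi)] at hneg
      exact lt_irrefl _ hneg
    have hle : #(P.tight (x + t • u)) ≤ P.m := (card_le_univ _).trans (by simp)
    obtain ⟨v, hv, hsub'⟩ := ih _ (by omega) ht rfl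
    exact ⟨v, hv, hsub.trans hsub'⟩

theorem exists_mem_facet (i : Fin P.m) : ∃ x, x ∈ P.facet i := by
  obtain ⟨y, hy⟩ := P.fullDim
  have hy : y ∈ P.carrier := interior_subset hy
  obtain ⟨x, hx, hxi⟩ : ∃ x : EuclideanSpace ℝ (Fin n),
      (∀ j, j ≠ i → 0 ≤ inner ℝ (P.a j) x + P.b j) ∧ inner ℝ (P.a i) x + P.b i < 0 := by
    by_contra! hcon
    refine P.irredundant i (Set.Subset.antisymm ?_ fun x hx j _ => hx j)
    intro x hx j
    by_cases hj : j = i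
    · subst hj
      exact hcon x hx
    · exact hx j hj
  have hyi := hy i
  set p := inner ℝ (P.a i) y + P.b i
  set q := inner ℝ (P.a i) x + P.b i with hq
  have hpq : 0 < p - q := by linarith
  -- `x` violates only the inequality `i`, by irredundancy. The value at `i` along the segment from
  -- `y` to `x` is (1 - l) p + l q, which vanishes for this `l`.
  set l := p / (p - q) with hl
  have hl0 : 0 ≤ l := div_nonneg hyi hpq.le
  have hl1 : l ≤ 1 := (div_le_one hpq).2 (by linarith)
  have hf : ∀ j, inner ℝ (P.a j) (y + l • (x - y)) + P.b j =
      (1 - l) * (inner ℝ (P.a j) y + P.b j) + l * (inner ℝ (P.a j) x + P.b j) := by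
    intro j
    rw [inner_add_right, inner_smul_right, inner_sub_right]
    ring
  have hzero : inner ℝ (P.a i) (y + l • (x - y)) + P.b i = 0 := by
    rw [hf i]
    change (1 - l) * p + l * q = 0
    rw [hl]
    field_simp
    ring
  refine ⟨y + l • (x - y), fun j => ?_, hzero⟩
  by_cases hj : j = i
  · subst hj
    exact hzero.ge
  · rw [hf j]
    exact add_nonneg (mul_nonneg (by linarith) (hy j)) (mul_nonneg hl0 (hx j hj))

theorem tight_subset_of_between {v d : EuclideanSpace ℝ (Fin n)} {s t : ℝ} (hv : v ∈ P.carrier)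
    (hw : v + t • d ∈ P.carrier) (hs : 0 < s) (hst : s < t) :
    P.tight (v + s • d) ⊆ P.tight v ∩ P.tight (v + t • d) := by
  intro j hj
  have h1 := hv j
  have h2 := hw j
  have h3 := mem_tight.1 hj
  rw [mem_inter, mem_tight, mem_tight]
  rw [inner_add_right, inner_smul_right] at h2 h3 ⊢
  have hneg : inner ℝ (P.a j) d = 0 := by
    refine le_antisymm ?_ ?_
    · by_contra! h
      have := mul_pos hs h
      linarith
    · by_contra! h
      have := mul_pos (sub_pos.2 hst) (neg_pos.2 h)
      nlinarith
  rw [hneg] at h3 ⊢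
  constructor <;> linarith

theorem IsSimple.card_tight (hP : P.IsSimple) {v : EuclideanSpace ℝ (Fin n)}
    (hv : P.IsVertex v) : #(P.tight v) = n := by
  refine Eq.trans ?_ (hP v hv)
  rw [← Set.ncard_coe_finset]
  congr 1
  ext i
  simp [mem_facet, hv.mem_carrier]

/-- At a simple vertex the n tight normals form a basis, and `d i` is the edge direction leaving
facet `i` while staying in the others. -/
theorem IsSimple.exists_dual_basis (hP : P.IsSimple) {v : EuclideanSpace ℝ (Fin n)}
    (hv : P.IsVertex v) : ∃ d : Fin P.m → EuclideanSpace ℝ (Fin n), ∀ i ∈ P.tight v,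
      ∀ j ∈ P.tight v, inner ℝ (P.a j) (d i) = if j = i then 1 else 0 := by
  let φ : EuclideanSpace ℝ (Fin n) →ₗ[ℝ] (P.tight v → ℝ) :=
    LinearMap.pi fun j => (innerSL ℝ (P.a j)).toLinearMap
  have hinj : Function.Injective φ := by
    rw [← LinearMap.ker_eq_bot, LinearMap.ker_eq_bot']
    intro u hu
    exact (isVertex_iff.1 hv).2 u fun i hi => congrFun hu ⟨i, hi⟩
  have hsurj : Function.Surjective φ :=
    (LinearMap.injective_iff_surjective_of_finrank_eq_finrank
      (by simp [hP.card_tight hv])).1 hinj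
  choose g hg using hsurj
  refine ⟨fun i => g fun j => if (j : Fin P.m) = i then 1 else 0, fun i _ j hj => ?_⟩
  exact congrFun (hg fun j => if (j : Fin P.m) = i then 1 else 0) ⟨j, hj⟩

theorem IsVertex.sub_eq_sum {v : EuclideanSpace ℝ (Fin n)} (hv : P.IsVertex v)
    {d : Fin P.m → EuclideanSpace ℝ (Fin n)} (hd : ∀ i ∈ P.tight v, ∀ j ∈ P.tight v,
      inner ℝ (P.a j) (d i) = if j = i then 1 else 0) (x : EuclideanSpace ℝ (Fin n)) :
    x - v = ∑ i ∈ P.tight v, (inner ℝ (P.a i) x + P.b i) • d i := by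
  rw [← sub_eq_zero]
  refine (isVertex_iff.1 hv).2 _ fun j hj => ?_
  have h1 := mem_tight.1 hj
  rw [inner_sub_right, inner_sub_right, inner_sum, sum_eq_single j]
  · rw [inner_smul_right, hd j hj j hj, if_pos rfl]
    linarith
  · intro i hi hij
    rw [inner_smul_right, hd i hi j hj, if_neg hij.symm, mul_zero]
  · exact fun h => absurd hj h

theorem IsVertex.exists_neighbor {v : EuclideanSpace ℝ (Fin n)} (hv : P.IsVertex v)
    {d : Fin P.m → EuclideanSpace ℝ (Fin n)} (hd : ∀ i ∈ P.tight v, ∀ j ∈ P.tight v,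
      inner ℝ (P.a j) (d i) = if j = i then 1 else 0) {i : Fin P.m} (hi : i ∈ P.tight v) :
    ∃ t : ℝ, 0 < t ∧ P.IsVertex (v + t • d i) ∧ (P.tight v).erase i ⊆ P.tight (v + t • d i) ∧
      i ∉ P.tight (v + t • d i) ∧ ∀ z ∈ P.carrier, (P.tight v).erase i ⊆ P.tight z →
        ∃ s, 0 ≤ s ∧ s ≤ t ∧ z = v + s • d i := by
  have hd0 : d i ≠ 0 := by
    intro h
    have := hd i hi i hi
    simp [h] at this
  obtain ⟨t, ht0, ht, l, hl, hneg⟩ := exists_exit hv.mem_carrier hd0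
  have hlt : 0 < t := by
    rcases ht0.lt_or_eq with h | h
    · exact h
    · subst h
      rw [zero_smul, add_zero] at hl
      rw [hd i hi l hl] at hneg
      split_ifs at hneg <;> linarith
  have hsub : (P.tight v).erase i ⊆ P.tight (v + t • d i) := by
    intro j hj
    obtain ⟨hji, hj⟩ := mem_erase.1 hj
    rw [mem_tight, inner_add_right, inner_smul_right, hd i hi j hj, if_neg hji]
    have := mem_tight.1 hj
    linarith
  refine ⟨t, hlt, ?_, hsub, ?_, ?_⟩
  · refine isVertex_iff.2 ⟨ht, fun u hu => ?_⟩
    -- Orthogonality to the tight normals other than `i` makes `u` a multiple of `d i`; the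
    -- inequality `l` that stops the ray then makes it zero.
    have h0 : u - inner ℝ (P.a i) u • d i = 0 := by
      refine (isVertex_iff.1 hv).2 _ fun j hj => ?_
      rw [inner_sub_right, inner_smul_right, hd i hi j hj]
      split_ifs with hji
      · rw [hji]
        ring
      · rw [hu j (hsub (mem_erase.2 ⟨hji, hj⟩))]
        ring
    rw [sub_eq_zero] at h0
    have h1 := hu l hl
    rw [h0, inner_smul_right] at h1
    rw [h0, (mul_eq_zero.1 h1).resolve_right hneg.ne, zero_smul]
  · rw [mem_tight, inner_add_right, inner_smul_right, hd i hi i hi, if_pos rfl]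
    have := mem_tight.1 hi
    intro h
    linarith
  · intro z hz hzsub
    have hzv := hv.sub_eq_sum hd z
    rw [sum_eq_single_of_mem i hi] at hzv
    · rw [sub_eq_iff_eq_add'] at hzv
      refine ⟨_, hz i, ?_, hzv⟩
      by_contra! hcon
      have h1 := hz l
      have h2 := mem_tight.1 hl
      rw [hzv, inner_add_right, inner_smul_right] at h1
      rw [inner_add_right, inner_smul_right] at h2
      nlinarith
    · intro j hj hji
      rw [mem_tight.1 (hzsub (mem_erase.2 ⟨hji, hj⟩)), zero_smul]

end General

/-! ### The combinatorial sphere of a simple polytope -/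

variable {P : ConvexPolytope 3}

/-- The vertices of a `3`-polytope, each given by the set of the facets through it. -/
noncomputable def vertexFamily (P : ConvexPolytope 3) : Finset (Finset (Fin P.m)) := by
  classical exact {t | ∃ v, P.IsVertex v ∧ P.tight v = t}

theorem mem_vertexFamily {t : Finset (Fin P.m)} :
    t ∈ P.vertexFamily ↔ ∃ v, P.IsVertex v ∧ P.tight v = t := by simp [vertexFamily]

/-- The simplex method: `w u - w t` is a nonnegative combination of the edge directions at `w t`,
with the slacks of `w u` as coefficients. Some term increases `f`; its slack is positive, so `i ∉
u`, and its direction leads to a higher neighbour. -/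
theorem exists_height (hP : P.IsSimple) {w : Finset (Fin P.m) → EuclideanSpace ℝ (Fin 3)}
    (hw : ∀ t ∈ P.vertexFamily, P.IsVertex (w t) ∧ P.tight (w t) = t)
    (f : Module.Dual ℝ (EuclideanSpace ℝ (Fin 3))) {t u : Finset (Fin P.m)}
    (ht : t ∈ P.vertexFamily) (hu : u ∈ P.vertexFamily) (hlt : f (w t) < f (w u)) :
    ∃ s ∈ P.vertexFamily, ∃ i ∈ t, i ∉ u ∧ t.erase i ⊆ s ∧ f (w t) < f (w s) := by
  obtain ⟨hv, htv⟩ := hw t ht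
  obtain ⟨hv', huv⟩ := hw u hu
  obtain ⟨d, hd⟩ := hP.exists_dual_basis hv
  have hsum := congrArg f (hv.sub_eq_sum hd (w u))
  rw [map_sub, map_sum] at hsum
  obtain ⟨i, hi, hpos⟩ : ∃ i ∈ P.tight (w t),
      0 < f ((inner ℝ (P.a i) (w u) + P.b i) • d i) := by
    by_contra! hcon
    have := sum_nonpos hcon
    linarith
  rw [map_smul, smul_eq_mul] at hpos
  have hne : 0 ≤ inner ℝ (P.a i) (w u) + P.b i := hv'.mem_carrier i
  have hfd : 0 < f (d i) := pos_of_mul_pos_right hpos hne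
  obtain ⟨r, hr, hver, hsub, -, -⟩ := hv.exists_neighbor hd hi
  have hs : P.tight (w t + r • d i) ∈ P.vertexFamily := mem_vertexFamily.2 ⟨_, hver, rfl⟩
  have hweq : w (P.tight (w t + r • d i)) = w t + r • d i :=
    hver.eq_of_tight_subset (hw _ hs).2.ge
  refine ⟨_, hs, i, htv ▸ hi, ?_, by rwa [htv] at hsub, ?_⟩
  · rw [← huv, mem_tight]
    intro h0
    simp [h0] at hpos
  · rw [hweq, map_add, map_smul, smul_eq_mul]
    have := mul_pos hr hfd
    linarith

theorem IsSimple.isSimpleSphere (hP : P.IsSimple) : IsSimpleSphere P.vertexFamily where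
  card_eq := by
    intro t ht
    obtain ⟨v, hv, rfl⟩ := mem_vertexFamily.1 ht
    exact hP.card_tight hv
  cover := by
    intro i
    obtain ⟨x, hx⟩ := P.exists_mem_facet i
    rw [mem_facet] at hx
    obtain ⟨v, hv, hsub⟩ := exists_isVertex hx.1
    exact ⟨_, mem_vertexFamily.2 ⟨v, hv, rfl⟩, hsub hx.2⟩
  card_star := by
    intro t ht i hi
    obtain ⟨v, hv, rfl⟩ := mem_vertexFamily.1 ht
    obtain ⟨d, hd⟩ := hP.exists_dual_basis hv
    obtain ⟨t, ht, hver, hsub, hni, hz⟩ := hv.exists_neighbor hd hi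
    rw [card_eq_two]
    refine ⟨P.tight v, P.tight (v + t • d i), fun h => hni (h ▸ hi), ?_⟩
    ext s
    simp only [mem_filter, mem_insert, mem_singleton]
    constructor
    · rintro ⟨hs, hsub'⟩
      obtain ⟨z, hzv, rfl⟩ := mem_vertexFamily.1 hs
      obtain ⟨s, hs0, hst, rfl⟩ := hz z hzv.mem_carrier hsub'
      rcases hs0.lt_or_eq with hs0 | rfl
      · rcases hst.lt_or_eq with hst | rfl
        · exfalso
          -- A vertex strictly inside the edge would lie only on the two facets of the edge, but it
          -- needs three.
          have h1 := tight_subset_of_between hv.mem_carrier hver.mem_carrier hs0 hst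
          have h2 : P.tight (v + s • d i) ⊆ (P.tight v).erase i := fun j hj =>
            mem_erase.2 ⟨fun h => hni (h ▸ (mem_inter.1 (h1 hj)).2), (mem_inter.1 (h1 hj)).1⟩
          have h3 := card_le_card h2
          rw [card_erase_of_mem hi, hP.card_tight hv, hP.card_tight hzv] at h3
          omega
        · exact Or.inr rfl
      · left
        simp
    · rintro (rfl | rfl)
      · exact ⟨mem_vertexFamily.2 ⟨v, hv, rfl⟩, erase_subset _ _⟩
      · exact ⟨mem_vertexFamily.2 ⟨_, hver, rfl⟩, hsub⟩
  exists_height := by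
    classical
    have : ∀ t : Finset (Fin P.m), ∃ v, t ∈ P.vertexFamily → P.IsVertex v ∧ P.tight v = t := by
      intro t
      by_cases ht : t ∈ P.vertexFamily
      · obtain ⟨v, hv⟩ := mem_vertexFamily.1 ht
        exact ⟨v, fun _ => hv⟩
      · exact ⟨0, fun h => absurd h ht⟩
    choose w hw using this
    -- A functional that vanishes on none of the finitely many differences of distinct vertices
    -- separates all vertices.
    obtain ⟨f, hf⟩ := Module.exists_dual_forall_apply_ne_zero (K := ℝ)
      (fun p : {p : P.vertexFamily × P.vertexFamily // p.1 ≠ p.2} =>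
        w (p.1.1 : Finset (Fin P.m)) - w (p.1.2 : Finset (Fin P.m))) (by
      rintro ⟨⟨⟨s, hs⟩, ⟨t, ht⟩⟩, hne⟩
      intro h
      refine hne (Subtype.ext ?_)
      have := sub_eq_zero.1 h
      simp only at this
      exact (hw s hs).2.symm.trans ((congrArg P.tight this).trans (hw t ht).2))
    refine ⟨fun t => f (w t), ?_, ?_, ?_⟩
    · intro s hs t ht hst
      by_contra hne
      refine hf ⟨⟨⟨s, hs⟩, ⟨t, ht⟩⟩, fun h => hne (congrArg Subtype.val h)⟩ ?_
      rw [map_sub]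
      exact sub_eq_zero.2 hst
    · intro t ht u hu hlt
      exact exists_height hP hw f ht hu hlt
    · intro t ht u hu hlt
      have := exists_height hP hw (-f) ht hu (by simpa using hlt)
      simpa using this

theorem face_nonempty_iff {S : Finset (Fin P.m)} :
    (P.face S).Nonempty ↔ ∃ t ∈ P.vertexFamily, S ⊆ t := by
  constructor
  · rintro ⟨x, hx, hS⟩
    obtain ⟨v, hv, hsub⟩ := exists_isVertex hx
    exact ⟨_, mem_vertexFamily.2 ⟨v, hv, rfl⟩, hS.trans hsub⟩
  · rintro ⟨t, ht, hS⟩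
    obtain ⟨v, hv, rfl⟩ := mem_vertexFamily.1 ht
    exact ⟨v, hv.mem_carrier, hS⟩

/-- The midpoint of the edge is such a point. It shows that the pair `e` can be read off from the
set `P.face e`. -/
theorem exists_tight_eq (hP : P.IsSimple) {e : Finset (Fin P.m)} (he : e ∈ edges P.vertexFamily) :
    ∃ x ∈ P.carrier, P.tight x = e := by
  obtain ⟨t, ht, hsub, h2⟩ := mem_edges.1 he
  obtain ⟨i, hi, rfl⟩ := hP.isSimpleSphere.exists_eq_erase ht hsub h2
  obtain ⟨v, hv, rfl⟩ := mem_vertexFamily.1 ht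
  obtain ⟨d, hd⟩ := hP.exists_dual_basis hv
  obtain ⟨t, ht, hver, hsub, hni, hz⟩ := hv.exists_neighbor hd hi
  have h1 := tight_subset_of_between hv.mem_carrier hver.mem_carrier (half_pos ht)
    (half_lt_self ht)
  have hw := hver.mem_carrier
  refine ⟨v + (t / 2) • d i, fun j => ?_, Subset.antisymm ?_ ?_⟩
  · have h3 := hv.mem_carrier j
    have h4 := hw j
    rw [inner_add_right, inner_smul_right] at h4 ⊢
    linarith
  · exact fun j hj =>
      mem_erase.2 ⟨fun h => hni (h ▸ (mem_inter.1 (h1 hj)).2), (mem_inter.1 (h1 hj)).1⟩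
  · intro j hj
    have h3 := mem_tight.1 (mem_of_mem_erase hj)
    have h4 := mem_tight.1 (hsub hj)
    rw [mem_tight]
    rw [inner_add_right, inner_smul_right] at h4 ⊢
    linarith

theorem face_subset_facet_iff (hP : P.IsSimple) {e : Finset (Fin P.m)}
    (he : e ∈ edges P.vertexFamily) {i : Fin P.m} : P.face e ⊆ P.facet i ↔ i ∈ e := by
  constructor
  · intro h
    obtain ⟨x, hx, hxe⟩ := exists_tight_eq hP he
    have := h ⟨hx, hxe.ge⟩
    rw [← hxe]
    exact (mem_facet.1 this).2
  · exact fun hi x hx => mem_facet.2 ⟨hx.1, hx.2 hi⟩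

theorem face_injOn (hP : P.IsSimple) : Set.InjOn P.face (edges P.vertexFamily) := by
  intro e he e' he' h
  obtain ⟨x, hx, hxe⟩ := exists_tight_eq hP he
  have : x ∈ P.face e' := h ▸ ⟨hx, hxe.ge⟩
  refine (eq_of_subset_of_card_le (hxe ▸ this.2) ?_).symm
  rw [card_of_mem_edges he, card_of_mem_edges he']

theorem isEdge_iff (hP : P.IsSimple) {G : Set (EuclideanSpace ℝ (Fin 3))} :
    P.IsEdge G ↔ ∃ e ∈ edges P.vertexFamily, G = P.face e := by
  rw [IsEdge, isFace_iff]
  constructor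
  · rintro ⟨⟨S, rfl⟩, hdim⟩
    have hne : (P.face S).Nonempty := by
      rw [Set.nonempty_iff_ne_empty]
      intro h
      rw [h, vectorSpan_empty, finrank_bot] at hdim
      omega
    obtain ⟨t, ht, hSt⟩ := face_nonempty_iff.1 hne
    obtain ⟨v, hv, rfl⟩ := mem_vertexFamily.1 ht
    obtain ⟨d, hd⟩ := hP.exists_dual_basis hv
    have hvS : v ∈ P.face S := ⟨hv.mem_carrier, hSt⟩
    have hdS : ∀ i ∈ P.tight v \ S, d i ∈ vectorSpan ℝ (P.face S) := by
      intro i hi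
      rw [mem_sdiff] at hi
      obtain ⟨t, ht, hver, hsub, hni, hz⟩ := hv.exists_neighbor hd hi.1
      have hw : v + t • d i ∈ P.face S := ⟨hver.mem_carrier, fun j hj =>
        hsub (mem_erase.2 ⟨fun h => hi.2 (h ▸ hj), hSt hj⟩)⟩
      have := vsub_mem_vectorSpan ℝ hw hvS
      rw [vsub_eq_sub, add_sub_cancel_left] at this
      exact ((vectorSpan ℝ (P.face S)).smul_mem_iff ht.ne').1 this
    -- The directions `d i` for tight `i ∉ S` are independent and lie in the direction space of the
    -- face, which is a line.
    have h1 : #(P.tight v \ S) ≤ 1 := by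
      rw [card_le_one]
      intro i hi j hj
      by_contra hij
      obtain ⟨e, he⟩ := finrank_le_one_iff.1 hdim.le
      obtain ⟨c, hc⟩ := he ⟨d i, hdS i hi⟩
      obtain ⟨c', hc'⟩ := he ⟨d j, hdS j hj⟩
      have hc : c • (e : EuclideanSpace ℝ (Fin 3)) = d i := congrArg Subtype.val hc
      have hc' : c' • (e : EuclideanSpace ℝ (Fin 3)) = d j := congrArg Subtype.val hc'
      have hi := (mem_sdiff.1 hi).1
      have hj := (mem_sdiff.1 hj).1
      have e1 := hd i hi i hi
      have e2 := hd j hj i hi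
      have e3 := hd j hj j hj
      rw [← hc, inner_smul_right, if_pos rfl] at e1
      rw [← hc', inner_smul_right, if_neg hij] at e2
      rw [← hc', inner_smul_right, if_pos rfl] at e3
      rcases mul_eq_zero.1 e2 with h | h
      · rw [h, zero_mul] at e3
        norm_num at e3
      · rw [h, mul_zero] at e1
        norm_num at e1
    have h0 : #(P.tight v \ S) ≠ 0 := by
      intro h0
      rw [card_eq_zero, sdiff_eq_empty_iff_subset] at h0
      have hS : P.face S = {v} := by
        refine Set.Subset.antisymm (fun x hx => ?_) (by rintro _ rfl; exact hvS)
        exact hv.eq_of_tight_subset (h0.trans hx.2)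
      rw [hS, vectorSpan_singleton, finrank_bot] at hdim
      omega
    have h3 := hP.card_tight hv
    have h4 := card_sdiff_of_subset hSt
    have h5 := card_le_card hSt
    exact ⟨S, mem_edges_of_subset ht hSt (by omega), rfl⟩
  · rintro ⟨e, he, rfl⟩
    refine ⟨⟨e, rfl⟩, ?_⟩
    obtain ⟨t, ht, hsub, h2⟩ := mem_edges.1 he
    obtain ⟨i, hi, rfl⟩ := hP.isSimpleSphere.exists_eq_erase ht hsub h2
    obtain ⟨v, hv, rfl⟩ := mem_vertexFamily.1 ht
    obtain ⟨d, hd⟩ := hP.exists_dual_basis hv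
    obtain ⟨t, ht, hver, hsub, hni, hz⟩ := hv.exists_neighbor hd hi
    have hd0 : d i ≠ 0 := by
      intro h
      have := hd i hi i hi
      simp [h] at this
    have hspan : vectorSpan ℝ (P.face ((P.tight v).erase i)) = ℝ ∙ d i := by
      refine le_antisymm ?_ ?_
      · rw [vectorSpan, Submodule.span_le]
        rintro _ ⟨x, hx, y, hy, rfl⟩
        obtain ⟨s, -, -, rfl⟩ := hz x hx.1 hx.2
        obtain ⟨r, -, -, rfl⟩ := hz y hy.1 hy.2
        refine Submodule.mem_span_singleton.2 ⟨s - r, ?_⟩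
        simp only [vsub_eq_sub, sub_smul]
        abel
      · rw [Submodule.span_singleton_le_iff_mem]
        have hvS : v ∈ P.face ((P.tight v).erase i) := ⟨hv.mem_carrier, erase_subset _ _⟩
        have hw : v + t • d i ∈ P.face ((P.tight v).erase i) := ⟨hver.mem_carrier, hsub⟩
        have := vsub_mem_vectorSpan ℝ hw hvS
        rw [vsub_eq_sub, add_sub_cancel_left] at this
        exact (Submodule.smul_mem_iff _ ht.ne').1 this
    rw [hspan, finrank_span_singleton hd0]

theorem isEdge_facet_inter_iff (hP : P.IsSimple) {i j : Fin P.m} :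
    P.IsEdge (P.facet i ∩ P.facet j) ↔ i ≠ j ∧ {i, j} ∈ edges P.vertexFamily := by
  rw [isEdge_iff hP, facet_inter_facet]
  constructor
  · rintro ⟨e, he, h⟩
    obtain ⟨x, hx, hxe⟩ := exists_tight_eq hP he
    have hxf : x ∈ P.face {i, j} := h ▸ ⟨hx, hxe.ge⟩
    have hsub : {i, j} ⊆ e := hxe ▸ hxf.2
    -- A whole facet is not an edge: leaving the other facet `k` of `e` along `d k` stays in facet
    -- `i` but not in `P.face e`.
    have hij : i ≠ j := by
      rintro rfl
      simp only [pair_eq_singleton, singleton_subset_iff] at hsub h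
      obtain ⟨k, hk, hki⟩ := exists_mem_ne (by rw [card_of_mem_edges he]; omega : 1 < #e) i
      obtain ⟨t, ht, het, -⟩ := mem_edges.1 he
      obtain ⟨v, hv, rfl⟩ := mem_vertexFamily.1 ht
      obtain ⟨d, hd⟩ := hP.exists_dual_basis hv
      obtain ⟨t, ht, hver, hsub', hni, hz⟩ := hv.exists_neighbor hd (het hk)
      have : v + t • d k ∈ P.face {i} := ⟨hver.mem_carrier,
        singleton_subset_iff.2 (hsub' (mem_erase.2 ⟨hki.symm, het hsub⟩))⟩
      rw [h] at this
      exact hni (this.2 hk)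
    refine ⟨hij, ?_⟩
    rwa [eq_of_subset_of_card_le hsub (by rw [card_of_mem_edges he, card_pair hij])]
  · rintro ⟨-, he⟩
    exact ⟨_, he, rfl⟩

theorem edgesOf_eq_image (hP : P.IsSimple) (i : Fin P.m) :
    P.edgesOf i = P.face '' ({e ∈ edges P.vertexFamily | i ∈ e} : Finset (Finset (Fin P.m))) := by
  ext G
  simp only [edgesOf, Set.mem_ofPred_eq, isEdge_iff hP, coe_filter, Set.mem_image]
  constructor
  · rintro ⟨⟨e, he, rfl⟩, hG⟩
    exact ⟨e, ⟨he, (face_subset_facet_iff hP he).1 hG⟩, rfl⟩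
  · rintro ⟨e, ⟨he, hi⟩, rfl⟩
    exact ⟨⟨e, he, rfl⟩, (face_subset_facet_iff hP he).2 hi⟩

theorem isGon_iff (hP : P.IsSimple) {k : ℕ} {i : Fin P.m} :
    P.IsGon k i ↔ degree P.vertexFamily i = k := by
  rw [IsGon, edgesOf_eq_image hP, Set.InjOn.ncard_image, Set.ncard_coe_finset,
    hP.isSimpleSphere.card_edges_mem_eq_degree]
  exact (face_injOn hP).mono (coe_subset.2 (filter_subset _ _))

end ConvexPolytope

/-! ### Belts and the quadrangle -/

namespace ConvexPolytope

variable {P : ConvexPolytope 3}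

theorem facet_inter_nonempty_iff {i j : Fin P.m} (hij : i ≠ j) :
    (P.facet i ∩ P.facet j).Nonempty ↔ {i, j} ∈ edges P.vertexFamily := by
  rw [facet_inter_facet, face_nonempty_iff, mem_edges]
  simp [card_pair hij]

theorem facet_nonempty (i : Fin P.m) : (P.facet i).Nonempty := P.exists_mem_facet i

theorem pentHex_iff (hP : P.IsSimple) : P.PentHexWithException ↔ PentHex P.vertexFamily := by
  simp only [PentHexWithException, isGon_iff hP]
  constructor
  · rintro ⟨h1, h2⟩
    refine ⟨fun i => ?_, fun i => ?_, h2⟩ <;> have := h1 i <;> omega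
  · rintro ⟨h1, h2, h3⟩
    refine ⟨fun i => ?_, h3⟩
    have := h1 i
    have := h2 i
    omega

/-- A 4-belt is a chordless 4-cycle of adjacent facets; the empty common intersection follows from
opposite facets being disjoint. -/
theorem isBelt_four_iff (hP : P.IsSimple) {B : ZMod 4 → Fin P.m} : P.IsBelt B ↔
    (∀ j, B j ≠ B (j + 1) ∧ {B j, B (j + 1)} ∈ edges P.vertexFamily) ∧
      ∀ j, B j ≠ B (j + 2) ∧ {B j, B (j + 2)} ∉ edges P.vertexFamily := by
  simp only [IsBelt, IsLoop, isEdge_facet_inter_iff hP]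
  refine and_congr_right fun h => ⟨?_, ?_⟩
  · rintro ⟨-, h2⟩ j
    have hempty : ¬ (P.facet (B j) ∩ P.facet (B (j + 2))).Nonempty := by
      have hd : ∀ j : ZMod 4, j ≠ j + 2 ∧ ¬ (j + 2 = j + 1 ∨ j = j + 2 + 1) := by decide
      rw [h2 _ _ (hd j).1]
      exact (hd j).2
    have hne : B j ≠ B (j + 2) := by
      intro he
      rw [← he, Set.inter_self] at hempty
      exact hempty (facet_nonempty _)
    exact ⟨hne, by rwa [facet_inter_nonempty_iff hne] at hempty⟩
  · intro h2
    constructor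
    · rw [Set.eq_empty_iff_forall_notMem]
      intro x hx
      rw [Set.mem_iInter] at hx
      have := h2 0
      rw [← facet_inter_nonempty_iff this.1] at this
      exact this.2 ⟨x, hx _, hx _⟩
    · intro p q hpq
      have hd : ∀ p q : ZMod 4, p ≠ q → q = p + 1 ∨ p = q + 1 ∨ q = p + 2 := by decide
      rcases hd p q hpq with rfl | rfl | rfl
      · simp [facet_inter_nonempty_iff (h p).1, (h p).2]
      · rw [Set.inter_comm]
        simp [facet_inter_nonempty_iff (h q).1, (h q).2]
      · have hd : ∀ j : ZMod 4, ¬ (j + 2 = j + 1 ∨ j = j + 2 + 1) := by decide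
        rw [facet_inter_nonempty_iff (h2 p).1]
        exact iff_of_false (h2 p).2 (hd p)

theorem exists_quadrangle_of_isBelt (hP : P.IsSimple) (hE : P.PentHexWithException)
    {B : ZMod 4 → Fin P.m} (hB : P.IsBelt B) :
    ∃ q, P.IsGon 4 q ∧ ∀ j, B j ≠ q ∧ {q, B j} ∈ edges P.vertexFamily := by
  rw [isBelt_four_iff hP] at hB
  rw [pentHex_iff hP] at hE
  have : Nonempty (Fin P.m) := ⟨B 0⟩
  obtain ⟨h1, h2⟩ := hB
  obtain ⟨q, hq, hadj⟩ := exists_quadrangle_of_square hP.isSimpleSphere hE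
    (a := B 0) (b := B 1) (c := B 2) (d := B 3)
    (nodup_four_iff.2 ⟨⟨(h1 0).1, (h2 0).1, (h1 3).1.symm⟩, ⟨(h1 1).1, (h2 1).1⟩, (h1 2).1⟩)
    (h1 0).2 (h1 1).2 (h1 2).2 (h1 3).2 (h2 0).2 (h2 1).2
  refine ⟨q, (isGon_iff hP).2 hq, fun j => hadj _ ?_⟩
  have hd : ∀ j : ZMod 4, j = 0 ∨ j = 1 ∨ j = 2 ∨ j = 3 := by decide
  rcases hd j with rfl | rfl | rfl | rfl <;> tauto

/-- The map `σ` moves by ±1 at each step and never turns back, since positions two apart have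
different images; so it is a rotation or a reflection. -/
theorem sameCyclic_of_four {α : Type*} {B C : ZMod 4 → α} (σ : ZMod 4 → ZMod 4)
    (hσ : ∀ j, C j = B (σ j)) (h1 : ∀ j, σ (j + 1) ≠ σ j ∧ σ (j + 1) ≠ σ j + 2)
    (h2 : ∀ j, σ (j + 2) ≠ σ j) : SameCyclic B C := by
  have key : ∀ s t u : ZMod 4, t ≠ s ∧ t ≠ s + 2 → u ≠ t ∧ u ≠ t + 2 → u ≠ s →
      (t = s + 1 ∧ u = t + 1) ∨ (t = s - 1 ∧ u = t - 1) := by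
    decide
  have hd : ∀ j : ZMod 4, j = 0 ∨ j = 1 ∨ j = 2 ∨ j = 3 := by decide
  have hne : ∀ s : ZMod 4, s + 1 ≠ s - 1 := by decide
  have hadd : ∀ s : ZMod 4, s + 1 + 1 = s + 2 ∧ s + 1 + 1 + 1 = s + 3 ∧ s - 1 - 1 = s - 2 ∧
      s - 1 - 1 - 1 = s - 3 := by decide
  rcases key (σ 0) (σ 1) (σ 2) (h1 0) (h1 1) (h2 0) with ⟨e1, e2⟩ | ⟨e1, e2⟩ <;>
    rcases key (σ 1) (σ 2) (σ 3) (h1 1) (h1 2) (h2 1) with ⟨f1, f2⟩ | ⟨f1, f2⟩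
  · refine Or.inl ⟨σ 0, fun j => ?_⟩
    rw [hσ]
    rcases hd j with rfl | rfl | rfl | rfl
    · rw [add_zero]
    · rw [e1]
    · rw [e2, e1, (hadd _).1]
    · rw [f2, e2, e1, (hadd _).2.1]
  · exact absurd (e2.symm.trans f1) (hne _)
  · exact absurd (f1.symm.trans e2) (hne _)
  · refine Or.inr ⟨σ 0, fun j => ?_⟩
    rw [hσ]
    rcases hd j with rfl | rfl | rfl | rfl
    · rw [sub_zero]
    · rw [e1]
    · rw [e2, e1, (hadd _).2.2.1]
    · rw [f2, e2, e1, (hadd _).2.2.2]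

theorem exists_unique_belt (hP : P.IsSimple) (hE : P.PentHexWithException) {F : Fin P.m}
    (hF : P.IsGon 4 F) : ∃ B : ZMod 4 → Fin P.m, P.IsBelt B ∧ P.Surrounds B F ∧
      ∀ C : ZMod 4 → Fin P.m, P.IsBelt C → SameCyclic B C := by
  have hE' := (pentHex_iff hP).1 hE
  have : Nonempty (Fin P.m) := ⟨F⟩
  have hK := hP.isSimpleSphere
  have hd : ∀ j : ZMod 4, j = 0 ∨ j = 1 ∨ j = 2 ∨ j = 3 := by decide
  obtain ⟨B, hinj, hstar, hn2, hlink⟩ : ∃ B : ZMod 4 → Fin P.m, Function.Injective B ∧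
      (∀ j, {F, B j, B (j + 1)} ∈ P.vertexFamily) ∧
      (∀ j, {B j, B (j + 2)} ∉ edges P.vertexFamily) ∧
      ∀ x, x ≠ F → ({F, x} ∈ edges P.vertexFamily ↔ ∃ j, x = B j) := by
    obtain ⟨a, b, c, d, hn, ⟨h1, h2, h3, h4⟩, hac, hbd, hl⟩ :=
      exists_square_of_quadrangle hK hE' ((isGon_iff hP).1 hF)
    obtain ⟨⟨nab, nac, nad⟩, ⟨nbc, nbd⟩, ncd⟩ := nodup_four_iff.1 hn
    obtain ⟨B, e0, e1, e2, e3⟩ : ∃ B : ZMod 4 → Fin P.m, B 0 = a ∧ B 1 = b ∧ B 2 = c ∧ B 3 = d :=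
      ⟨![a, b, c, d], rfl, rfl, rfl, rfl⟩
    have a0 : (0 : ZMod 4) + 1 = 1 := rfl
    have a1 : (1 : ZMod 4) + 1 = 2 := rfl
    have a2 : (2 : ZMod 4) + 1 = 3 := rfl
    have a3 : (3 : ZMod 4) + 1 = 0 := rfl
    have b0 : (0 : ZMod 4) + 2 = 2 := rfl
    have b1 : (1 : ZMod 4) + 2 = 3 := rfl
    have b2 : (2 : ZMod 4) + 2 = 0 := rfl
    have b3 : (3 : ZMod 4) + 2 = 1 := rfl
    refine ⟨B, ?_, ?_, ?_, ?_⟩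
    · intro i j hij
      rcases hd i with rfl | rfl | rfl | rfl <;> rcases hd j with rfl | rfl | rfl | rfl <;>
        simp only [e0, e1, e2, e3] at hij <;>
        first
        | exact absurd hij (by assumption)
        | exact absurd hij.symm (by assumption)
        | rfl
    · intro j
      rcases hd j with rfl | rfl | rfl | rfl
      · rwa [a0, e0, e1]
      · rwa [a1, e1, e2]
      · rwa [a2, e2, e3]
      · rwa [a3, e3, e0]
    · intro j
      rcases hd j with rfl | rfl | rfl | rfl
      · rwa [b0, e0, e2]
      · rwa [b1, e1, e3]
      · rwa [b2, e2, e0, pair_comm]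
      · rwa [b3, e3, e1, pair_comm]
    · intro x hx
      rw [hl x hx]
      constructor
      · rintro (rfl | rfl | rfl | rfl)
        exacts [⟨0, e0.symm⟩, ⟨1, e1.symm⟩, ⟨2, e2.symm⟩, ⟨3, e3.symm⟩]
      · rintro ⟨j, rfl⟩
        rcases hd j with rfl | rfl | rfl | rfl
        exacts [Or.inl e0, Or.inr (Or.inl e1), Or.inr (Or.inr (Or.inl e2)),
          Or.inr (Or.inr (Or.inr e3))]
  have hne1 : ∀ j, B j ≠ B (j + 1) := fun j => hinj.ne (by revert j; decide)
  have hne2 : ∀ j, B j ≠ B (j + 2) := fun j => hinj.ne (by revert j; decide)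
  have hFB : ∀ j, B j ≠ F := by
    intro j h
    have h3 := hK.card_eq _ (hstar j)
    rw [h] at h3
    have := card_le_two (a := F) (b := B (j + 1))
    simp only [mem_insert_self, insert_eq_of_mem] at h3
    omega
  have hFE : ∀ j, {F, B j} ∈ edges P.vertexFamily := fun j => (hlink _ (hFB j)).2 ⟨j, rfl⟩
  have hBelt : P.IsBelt B := by
    refine (isBelt_four_iff hP).2 ⟨fun j => ⟨hne1 j, ?_⟩, fun j => ⟨hne2 j, hn2 j⟩⟩
    refine mem_edges_of_subset (hstar j) ?_ (card_pair (hne1 j))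
    exact subset_insert _ _
  refine ⟨B, hBelt, ⟨?_, ?_, ?_⟩, ?_⟩
  · intro i j hij
    simp only [facet_inter_facet] at hij
    have he := face_injOn hP (hFE i) (hFE j) hij
    have : B i ∈ ({F, B j} : Finset (Fin P.m)) := by rw [← he]; simp
    simp only [mem_insert, mem_singleton] at this
    exact hinj (this.resolve_left (hFB i))
  · rw [edgesOf_eq_image hP]
    ext G
    simp only [facet_inter_facet, Set.mem_range, coe_filter, Set.mem_image, Set.mem_ofPred_eq]
    constructor
    · rintro ⟨j, rfl⟩
      exact ⟨_, ⟨hFE j, by simp⟩, rfl⟩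
    · rintro ⟨e, ⟨he, hFe⟩, rfl⟩
      obtain ⟨x, hx⟩ := card_eq_one.1
        (show #(e.erase F) = 1 by rw [card_erase_of_mem hFe, card_of_mem_edges he])
      have hxe : x ∈ e.erase F := by simp [hx]
      have heq : e = {F, x} := by rw [← insert_erase hFe, hx]
      rw [heq] at he
      obtain ⟨j, rfl⟩ := (hlink x (mem_erase.1 hxe).1).1 he
      exact ⟨j, by rw [heq]⟩
  · intro j
    obtain ⟨x, hx, hsub⟩ := face_nonempty_iff.2 ⟨_, hstar j, Subset.rfl⟩
    simp only [insert_subset_iff, singleton_subset_iff] at hsub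
    exact ⟨x, ⟨mem_facet.2 ⟨hx, hsub.1⟩, mem_facet.2 ⟨hx, hsub.2.1⟩⟩, mem_facet.2 ⟨hx, hsub.2.2⟩⟩
  · intro C hC
    obtain ⟨q, hq, hadj⟩ := exists_quadrangle_of_isBelt hP hE hC
    -- Any 4-belt consists of neighbours of a quadrangle, which is `F` as there is only one
    -- exceptional facet. So `C` runs through the facets of `B`, and opposite facets of `B`, not
    -- being adjacent, cannot be successive in `C`.
    obtain rfl : q = F := hE.2 q F (Or.inl hq) (Or.inl hF)
    have hσ : ∀ j, ∃ k, C j = B k := fun j => (hlink _ (hadj j).1).1 (hadj j).2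
    choose σ hσ using hσ
    obtain ⟨c1, c2⟩ := (isBelt_four_iff hP).1 hC
    refine sameCyclic_of_four σ hσ (fun j => ⟨fun h => ?_, fun h => ?_⟩) fun j h => ?_
    · exact (c1 j).1 (by rw [hσ, hσ, h])
    · refine hn2 (σ j) ?_
      rw [← h, ← hσ, ← hσ]
      exact (c1 j).2
    · exact (c2 j).1 (by rw [hσ, hσ, h])

end ConvexPolytope

theorem mainTheorem4 :
    (∀ P : ConvexPolytope 3, P.IsSimple → P.PentHexWithException →
      ((¬ ∃ i, P.IsGon 4 i) → ¬ ∃ B : ZMod 4 → Fin P.m, P.IsBelt B) ∧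
      (∀ F : Fin P.m, P.IsGon 4 F →
        ∃ B : ZMod 4 → Fin P.m, P.IsBelt B ∧ P.Surrounds B F ∧
          ∀ C : ZMod 4 → Fin P.m, P.IsBelt C → SameCyclic B C)) ∧
    (∀ P : ConvexPolytope 3, P.IsFullerene → ¬ ∃ B : ZMod 4 → Fin P.m, P.IsBelt B) := by
  refine ⟨fun P hP hE => ⟨?_, fun F hF => ConvexPolytope.exists_unique_belt hP hE hF⟩, ?_⟩
  · rintro h4 ⟨B, hB⟩
    obtain ⟨q, hq, -⟩ := ConvexPolytope.exists_quadrangle_of_isBelt hP hE hB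
    exact h4 ⟨q, hq⟩
  · rintro P ⟨hP, h56⟩ ⟨B, hB⟩
    have hne : ∀ i, ¬ P.IsGon 4 i ∧ ¬ P.IsGon 7 i := by
      intro i
      have := h56 i
      simp only [ConvexPolytope.IsGon] at this ⊢
      omega
    have hE : P.PentHexWithException := by
      refine ⟨fun i => ?_, fun i j hi _ => ?_⟩
      · have := h56 i
        tauto
      · have := hne i
        tauto
    obtain ⟨q, hq, -⟩ := ConvexPolytope.exists_quadrangle_of_isBelt hP hE hB
    exact (hne q).1 hq
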